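/- Let $n\ge 1$, let $M_n$ be the algebra of complex $n\times n$ matrices, $\mathbb U_n$ its unitary group, and $\mathcal U_n=\mathbb U_n/(\mathbb T\cdot I)$ the quotient topological group, where $\mathbb T=\{z\in\mathbb C:|z|=1\}$. For a complex algebra with unit $\mathcal A$, $u\in\mathcal U_n$ and $A\in M_n(\mathcal A)$ put $u.A=UAU^{-1}$, where $U\in\mathbb U_n$ is any representative of $u$. An $n$-space $(X,.)$ is a locally compact Hausdorff space $X$ with a continuous free action of $\mathcal U_n$. Let $C^*(X,.)$ be the $*$-algebra of continuous functions $f:X\to M_n$ vanishing at infinity with $f(u.x)=u.f(x)$ for all $u\in\mathcal U_n$, $x\in X$, and let $\mathcal BC^*(X,.)$ be the $*$-algebra of bounded Borel functions $f:X\to M_n$ with the same equivariance (pointwise operations in both). Let $\mathcal B(X)$ be the Borel $\sigma$-algebra of $X$. A representation of such an algebra on a complex Hilbert space $H$ is a $*$-homomorphism into the algebra $B(H)$ of bounded operators (not assumed to be unital or nondegenerate). A regular operator-valued $n$-measure on $(X,.)$ is a function $E=[E_{jk}]:\mathcal B(X)\to M_n(B(H))$ such that for all $h,w\in H$ and all $j,k$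 the function $E_{jk}^{(h,w)}:A\mapsto\langle E_{jk}(A)h,w\rangle$ is a regular (countably additive) complex measure, and $E(u.A)=u.E(A)$ for all $u\in\mathcal U_n$ and $A\in\mathcal B(X)$. For a bounded Borel $f=[f_{jk}]:X\to M_n$ define $\int f\,dE=\sum_{j,k}\int_X f_{jk}\,dE_{kj}\in B(H)$, where the bounded operator $\int_X g\,dE_{kj}$ is determined by $\langle(\int_X g\,dE_{kj})h,w\rangle=\int_X g\,dE_{kj}^{(h,w)}$ for all $h,w\in H$. Such an $E$ is a spectral $n$-measure if $(\int f\,dE)^*=\int f^*\,dE$ and $\int f\cdot g\,dE=\int f\,dE\cdot\int g\,dE$ for all $f,g\in\mathcal BC^*(X,.)$. Theorem. Let $(X,.)$ be an $n$-space and let $\pi:C^*(X,.)\to B(H)$ be a representation on a complex Hilbert space $H$. Then there is a unique spectral $n$-measure $E:\mathcal B(X)\to M_n(B(H))$ such that $$\pi(f)=\int f\,dE\qquad\text{for all } f\in C^*(X,.).$$ In particular, $\pi$ extends to a representation of $\mathcal BC^*(X,.)$ on $H$. -/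

import Mathlib

open MeasureTheory
open scoped ENNReal NNReal Pointwise ZeroAtInfty InnerProductSpace

set_option linter.unusedSectionVars false

namespace NSpace

/-! ### The group `𝒰ₙ = 𝕌ₙ / (𝕋 · I)` and its action on matrices -/

/-- The subgroup `𝕋 · I` of the unitary group of `n × n` complex matrices. -/
def scalarUnitaries (n : ℕ) : Subgroup (Matrix.unitaryGroup (Fin n) ℂ) where
  carrier := {U | ∃ z : ℂ, ‖z‖ = 1 ∧ (U : Matrix (Fin n) (Fin n) ℂ) = z • 1}
  one_mem' := ⟨1, by simp, by simp⟩
  mul_mem' := by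
    rintro U V ⟨z, hz, hU⟩ ⟨w, hw, hV⟩
    refine ⟨z * w, by simp [hz, hw], ?_⟩
    simp [hU, hV, smul_smul, mul_comm]
  inv_mem' := by
    rintro U ⟨z, hz, hU⟩
    refine ⟨star z, by simpa using hz, ?_⟩
    change star (U : Matrix (Fin n) (Fin n) ℂ) = _
    rw [hU, star_smul, star_one]

instance scalarUnitaries_normal (n : ℕ) : (scalarUnitaries n).Normal where
  conj_mem := by
    rintro U ⟨z, hz, hU⟩ V
    refine ⟨z, hz, ?_⟩
    change (V : Matrix (Fin n) (Fin n) ℂ) * (U : Matrix (Fin n) (Fin n) ℂ) *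
      star (V : Matrix (Fin n) (Fin n) ℂ) = _
    rw [hU]
    have hV : (V : Matrix (Fin n) (Fin n) ℂ) * star (V : Matrix (Fin n) (Fin n) ℂ) = 1 :=
      Unitary.coe_mul_star_self V
    simp [hV]

/-- The compact group `𝒰ₙ = 𝕌ₙ / (𝕋 · I)`, with the quotient topology. -/
abbrev PU (n : ℕ) : Type := Matrix.unitaryGroup (Fin n) ℂ ⧸ scalarUnitaries n

/-- `U A U⁻¹` for a unitary complex matrix `U` and a matrix `A` with entries in a complex
algebra. -/
def unitaryConj {n : ℕ} {𝔸 : Type*} [Ring 𝔸] [Algebra ℂ 𝔸] (U : Matrix.unitaryGroup (Fin n) ℂ)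
    (A : Matrix (Fin n) (Fin n) 𝔸) : Matrix (Fin n) (Fin n) 𝔸 :=
  (U : Matrix (Fin n) (Fin n) ℂ).map (algebraMap ℂ 𝔸) * A *
    ((U⁻¹ : Matrix.unitaryGroup (Fin n) ℂ) : Matrix (Fin n) (Fin n) ℂ).map (algebraMap ℂ 𝔸)

lemma unitaryConj_mul_scalar {n : ℕ} {𝔸 : Type*} [Ring 𝔸] [Algebra ℂ 𝔸]
    (U V : Matrix.unitaryGroup (Fin n) ℂ) (hV : V ∈ scalarUnitaries n)
    (A : Matrix (Fin n) (Fin n) 𝔸) : unitaryConj (U * V) A = unitaryConj U A := by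
  obtain ⟨z, hz, hV⟩ := hV
  have hz' : z * star z = 1 := by
    have h := Complex.mul_conj' z
    rw [hz] at h
    simpa using h
  have h1 : ((U * V : Matrix.unitaryGroup (Fin n) ℂ) : Matrix (Fin n) (Fin n) ℂ)
      = z • (U : Matrix (Fin n) (Fin n) ℂ) := by
    change (U : Matrix (Fin n) (Fin n) ℂ) * (V : Matrix (Fin n) (Fin n) ℂ) = _
    rw [hV]; simp
  have h2 : (((U * V)⁻¹ : Matrix.unitaryGroup (Fin n) ℂ) : Matrix (Fin n) (Fin n) ℂ)
      = star z • ((U⁻¹ : Matrix.unitaryGroup (Fin n) ℂ) : Matrix (Fin n) (Fin n) ℂ) := by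
    change star ((U * V : Matrix.unitaryGroup (Fin n) ℂ) : Matrix (Fin n) (Fin n) ℂ) =
      star z • star (U : Matrix (Fin n) (Fin n) ℂ)
    rw [h1, star_smul]
  have h3 : ∀ (c : ℂ) (M : Matrix (Fin n) (Fin n) ℂ),
      (c • M).map (algebraMap ℂ 𝔸) = c • M.map (algebraMap ℂ 𝔸) := by
    intro c M
    ext i j
    simp only [Matrix.map_apply, Matrix.smul_apply, smul_eq_mul, map_mul]
    rw [Algebra.smul_def]
  unfold unitaryConj
  rw [h1, h2, h3, h3, Matrix.smul_mul, Matrix.smul_mul, Matrix.mul_smul, smul_smul, hz', one_smul]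

/-- `u . A := U A U⁻¹`, where `U` is any unitary matrix representing `u ∈ 𝒰ₙ`; here `A` is
a matrix with entries in a complex algebra. -/
def conj {n : ℕ} {𝔸 : Type*} [Ring 𝔸] [Algebra ℂ 𝔸] (u : PU n)
    (A : Matrix (Fin n) (Fin n) 𝔸) : Matrix (Fin n) (Fin n) 𝔸 :=
  Quotient.liftOn' u (fun U => unitaryConj U A) (by
    intro U V h
    rw [QuotientGroup.leftRel_apply] at h
    have := unitaryConj_mul_scalar U (U⁻¹ * V) h A
    rwa [mul_inv_cancel_left, eq_comm] at this)

@[simp]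
lemma conj_mk {n : ℕ} {𝔸 : Type*} [Ring 𝔸] [Algebra ℂ 𝔸] (U : Matrix.unitaryGroup (Fin n) ℂ)
    (A : Matrix (Fin n) (Fin n) 𝔸) : conj (U : PU n) A = unitaryConj U A := rfl

section conjAlgebra

variable {n : ℕ} (u : PU n)

lemma unitaryConj_complex (U : Matrix.unitaryGroup (Fin n) ℂ) (A : Matrix (Fin n) (Fin n) ℂ) :
    unitaryConj U A = (U : Matrix (Fin n) (Fin n) ℂ) * A * star (U : Matrix (Fin n) (Fin n) ℂ) :=
  rfl

lemma conj_add (A B : Matrix (Fin n) (Fin n) ℂ) : conj u (A + B) = conj u A + conj u B := by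
  induction u using QuotientGroup.induction_on with
  | H U => simp [unitaryConj_complex, mul_add, add_mul]

lemma conj_zero : conj u (0 : Matrix (Fin n) (Fin n) ℂ) = 0 := by
  induction u using QuotientGroup.induction_on with
  | H U => simp [unitaryConj_complex]

lemma conj_mul (A B : Matrix (Fin n) (Fin n) ℂ) : conj u (A * B) = conj u A * conj u B := by
  induction u using QuotientGroup.induction_on with
  | H U =>
    have h : star (U : Matrix (Fin n) (Fin n) ℂ) * (U : Matrix (Fin n) (Fin n) ℂ) = 1 :=
      Unitary.coe_star_mul_self U
    simp only [conj_mk, unitaryConj_complex]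
    calc (U : Matrix (Fin n) (Fin n) ℂ) * (A * B) * star (U : Matrix (Fin n) (Fin n) ℂ)
        = (U : Matrix (Fin n) (Fin n) ℂ) * A * 1 * B * star (U : Matrix (Fin n) (Fin n) ℂ) := by
          simp [mul_assoc]
      _ = _ := by rw [← h]; simp only [mul_assoc]

lemma conj_smul (c : ℂ) (A : Matrix (Fin n) (Fin n) ℂ) : conj u (c • A) = c • conj u A := by
  induction u using QuotientGroup.induction_on with
  | H U => simp [unitaryConj_complex]

lemma conj_star (A : Matrix (Fin n) (Fin n) ℂ) : conj u (star A) = star (conj u A) := by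
  induction u using QuotientGroup.induction_on with
  | H U => simp [unitaryConj_complex, mul_assoc]

end conjAlgebra

/-! ### The algebras `C*(X, .)` and `ℬC*(X, .)` -/

section algebras

variable (n : ℕ) (X : Type*) [TopologicalSpace X] [MulAction (PU n) X]

/-- `C*(X, .)`: the `*`-algebra of all continuous `f : X → Mₙ` vanishing at infinity such that
`f (u . x) = u . f x`. -/
def CStar : NonUnitalStarSubalgebra ℂ C₀(X, Matrix (Fin n) (Fin n) ℂ) where
  carrier := {f | ∀ (u : PU n) (x : X), f (u • x) = conj u (f x)}
  add_mem' := by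
    intro f g hf hg u x
    simp [hf u x, hg u x, conj_add]
  zero_mem' := by
    intro u x
    simp [conj_zero]
  mul_mem' := by
    intro f g hf hg u x
    simp [hf u x, hg u x, conj_mul]
  smul_mem' := by
    intro c f hf u x
    simp [hf u x, conj_smul]
  star_mem' := by
    intro f hf u x
    simp [hf u x, conj_star]

variable {n X} in
/-- Bounded Borel matrix-valued functions, entry by entry. -/
structure IsBoundedBorel [MeasurableSpace X] (f : X → Matrix (Fin n) (Fin n) ℂ) : Prop where
  measurable : ∀ j k, Measurable fun x => f x j k
  bounded : ∃ C : ℝ, ∀ x j k, ‖f x j k‖ ≤ C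

/-- `ℬC*(X, .)`: the `*`-algebra, with pointwise operations, of all bounded Borel functions
`f : X → Mₙ` such that `f (u . x) = u . f x`. -/
def BCStar [MeasurableSpace X] :
    NonUnitalStarSubalgebra ℂ (X → Matrix (Fin n) (Fin n) ℂ) where
  carrier := {f | IsBoundedBorel f ∧ ∀ (u : PU n) (x : X), f (u • x) = conj u (f x)}
  add_mem' := by
    rintro f g ⟨hf, hf'⟩ ⟨hg, hg'⟩
    obtain ⟨C, hC⟩ := hf.bounded
    obtain ⟨D, hD⟩ := hg.bounded
    refine ⟨⟨fun j k => (hf.measurable j k).add (hg.measurable j k), C + D, fun x j k =>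
      (norm_add_le _ _).trans (add_le_add (hC x j k) (hD x j k))⟩, fun u x => ?_⟩
    simp [hf' u x, hg' u x, conj_add]
  zero_mem' := by
    refine ⟨⟨fun j k => measurable_const, 0, by simp⟩, fun u x => ?_⟩
    simp [conj_zero]
  mul_mem' := by
    rintro f g ⟨hf, hf'⟩ ⟨hg, hg'⟩
    obtain ⟨C, hC⟩ := hf.bounded
    obtain ⟨D, hD⟩ := hg.bounded
    refine ⟨⟨fun j k => ?_, ∑ _i : Fin n, C * D, fun x j k => ?_⟩, fun u x => ?_⟩
    · simp only [Pi.mul_apply, Matrix.mul_apply]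
      exact Finset.measurable_fun_sum _ fun i _ => (hf.measurable j i).mul (hg.measurable i k)
    · simp only [Pi.mul_apply, Matrix.mul_apply]
      refine norm_sum_le_of_le _ fun i _ => ?_
      rw [norm_mul]
      exact mul_le_mul (hC x j i) (hD x i k) (norm_nonneg _) ((norm_nonneg _).trans (hC x j i))
    · simp [hf' u x, hg' u x, conj_mul]
  smul_mem' := by
    rintro c f ⟨hf, hf'⟩
    obtain ⟨C, hC⟩ := hf.bounded
    refine ⟨⟨fun j k => (hf.measurable j k).const_smul c, ‖c‖ * C, fun x j k => ?_⟩,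
      fun u x => ?_⟩
    · simp only [Pi.smul_apply, Matrix.smul_apply, norm_smul]
      exact mul_le_mul_of_nonneg_left (hC x j k) (norm_nonneg _)
    · simp [hf' u x, conj_smul]
  star_mem' := by
    rintro f ⟨hf, hf'⟩
    obtain ⟨C, hC⟩ := hf.bounded
    refine ⟨⟨fun j k => ?_, C, fun x j k => ?_⟩, fun u x => ?_⟩
    · simp only [Pi.star_apply, Matrix.star_apply]
      exact continuous_star.measurable.comp (hf.measurable k j)
    · simpa [Matrix.star_apply] using hC x k j
    · simp [hf' u x, conj_star]

variable {n X}

lemma isBoundedBorel_zeroAtInfty [MeasurableSpace X] [BorelSpace X]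
    (f : C₀(X, Matrix (Fin n) (Fin n) ℂ)) : IsBoundedBorel (n := n) (f : X → _) := by
  have hent : ∀ j k, Continuous fun x => f x j k := fun j k =>
    (continuous_id.matrix_elem j k).comp (map_continuous f)
  refine ⟨fun j k => (hent j k).measurable, ?_⟩
  have hb : ∀ j k, ∃ C : ℝ, ∀ x, ‖f x j k‖ ≤ C := by
    intro j k
    let g : C₀(X, ℂ) :=
      { toFun := fun x => f x j k
        continuous_toFun := hent j k
        zero_at_infty' := by
          have h1 : Continuous fun A : Matrix (Fin n) (Fin n) ℂ => A j k :=
            continuous_id.matrix_elem j k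
          have h2 := (h1.tendsto 0).comp (zero_at_infty f)
          exact h2 }
    exact ⟨‖g.toBCF‖, fun x => g.toBCF.norm_coe_le_norm x⟩
  choose C hC using hb
  refine ⟨∑ j, ∑ k, |C j k|, fun x j k => (hC j k x).trans ((le_abs_self _).trans ?_)⟩
  exact (Finset.single_le_sum (f := fun k => |C j k|) (fun _ _ => abs_nonneg _)
    (Finset.mem_univ k)).trans (Finset.single_le_sum (f := fun j => ∑ k, |C j k|)
    (fun _ _ => Finset.sum_nonneg fun _ _ => abs_nonneg _) (Finset.mem_univ j))

/-- The inclusion of `C*(X, .)` into `ℬC*(X, .)`. -/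
noncomputable def CStar.toBCStar [MeasurableSpace X] [BorelSpace X] : CStar n X →⋆ₙₐ[ℂ] BCStar n X where
  toFun f := ⟨fun x => (f : C₀(X, Matrix (Fin n) (Fin n) ℂ)) x,
    isBoundedBorel_zeroAtInfty _, f.2⟩
  map_smul' _ _ := rfl
  map_zero' := rfl
  map_add' _ _ := rfl
  map_mul' _ _ := rfl
  map_star' _ := rfl

end algebras

/-! ### Integration against complex measures -/

section complexMeasure

variable {X : Type*} [MeasurableSpace X]

/-- A complex measure is regular when its total variation is a regular measure. -/
def IsRegular [TopologicalSpace X] (ν : ComplexMeasure X) : Prop := ν.variation.Regular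

/-- The integral `∫ f dν` of a complex function against a complex measure. -/
noncomputable def cintegral (f : X → ℂ) (ν : ComplexMeasure X) : ℂ :=
  ν.integral f (ContinuousLinearMap.mul ℝ ℂ)

lemma variation_le_of_bound (ν : ComplexMeasure X) {C : ℝ≥0} (h : ∀ A, ‖ν A‖ ≤ C) :
    ν.variation Set.univ ≤ 4 * C := by
  have key : ∀ s : SignedMeasure X, (∀ A, ‖s A‖ ≤ C) → s.variation Set.univ ≤ 2 * C := by
    intro s hs
    by_contra hlt
    obtain ⟨t, -, -, ht⟩ :=
      s.exists_subset_lt_enorm_apply_of_lt_variation MeasurableSet.univ (not_le.1 hlt)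
    have : ‖s t‖ₑ ≤ C := by
      rw [enorm_eq_nnnorm]
      exact_mod_cast hs t
    exact absurd ht (not_lt.2 (by gcongr))
  have h1 := key (ComplexMeasure.re ν) fun A => (Complex.abs_re_le_norm (ν A)).trans (h A)
  have h2 := key (ComplexMeasure.im ν) fun A => (Complex.abs_im_le_norm (ν A)).trans (h A)
  have h3 : ν.variation ≤ (ComplexMeasure.re ν).variation + (ComplexMeasure.im ν).variation := by
    refine VectorMeasure.variation_le_of_forall_enorm_le fun A _ => ?_
    rw [Measure.add_apply]
    refine le_trans ?_ (add_le_add (VectorMeasure.enorm_measure_le_variation _ A)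
      (VectorMeasure.enorm_measure_le_variation _ A))
    simp only [enorm_eq_nnnorm]
    exact_mod_cast Complex.norm_le_abs_re_add_abs_im (ν A)
  calc ν.variation Set.univ ≤ _ := h3 Set.univ
    _ ≤ 2 * C + 2 * C := by
      rw [Measure.add_apply]
      exact add_le_add h1 h2
    _ = 4 * C := by ring

instance isFiniteMeasure_variation (ν : ComplexMeasure X) : IsFiniteMeasure ν.variation where
  measure_univ_lt_top :=
    (variation_le_of_bound ν fun _ => VectorMeasure.norm_apply_le_bound).trans_lt
      (ENNReal.mul_lt_top (by simp) ENNReal.coe_lt_top)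

lemma integrable_of_bounded (ν : ComplexMeasure X) {f : X → ℂ} (hf : Measurable f) {M : ℝ}
    (hM : ∀ x, ‖f x‖ ≤ M) : ν.Integrable f :=
  Integrable.of_bound hf.aestronglyMeasurable M (Filter.Eventually.of_forall hM)

lemma norm_cintegral_le (ν : ComplexMeasure X) {f : X → ℂ} {M : ℝ} (hM0 : 0 ≤ M)
    (hM : ∀ x, ‖f x‖ ≤ M) {C : ℝ≥0} (hC : ∀ A, ‖ν A‖ ≤ C) :
    ‖cintegral f ν‖ ≤ M * (4 * C) := by
  have h1 := VectorMeasure.norm_integral_le_of_norm_le_const (μ := ν)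
    (B := ContinuousLinearMap.mul ℝ ℂ) (f := f) (Filter.Eventually.of_forall hM)
  have h2 : ν.variation.real Set.univ ≤ 4 * C := by
    have := ENNReal.toReal_mono (by finiteness) (variation_le_of_bound ν hC)
    simpa [Measure.real] using this
  have h3 : ‖ContinuousLinearMap.mul ℝ ℂ‖ ≤ 1 := ContinuousLinearMap.opNorm_mul_le ℝ ℂ
  calc _ ≤ _ := h1
    _ ≤ M * 1 * (4 * C) := by gcongr
    _ = _ := by ring

lemma cintegral_add_measure (μ ν : ComplexMeasure X) {f : X → ℂ} (hf : Measurable f) {M : ℝ}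
    (hM : ∀ x, ‖f x‖ ≤ M) : cintegral f (μ + ν) = cintegral f μ + cintegral f ν :=
  VectorMeasure.integral_add_vectorMeasure (integrable_of_bounded μ hf hM)
    (integrable_of_bounded ν hf hM)

lemma cintegral_smul_measure (c : ℂ) (ν : ComplexMeasure X) (f : X → ℂ) :
    cintegral f (c • ν) = c * cintegral f ν := by
  let B : ℂ →L[ℝ] ℂ →L[ℝ] ℂ := ContinuousLinearMap.mul ℝ ℂ
  have hTapp : ∀ (μ : ComplexMeasure X) (s : Set X) (x : ℂ), μ.transpose B s x = x * μ s :=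
    fun μ s x => cbmApplyMeasure_apply μ B s x
  have hT := dominatedFinMeasAdditive_cbmApplyMeasure ν B
  have hv : (c • ν).variation = ‖c‖₊ • ν.variation := VectorMeasure.variation_smul
  have hcT : DominatedFinMeasAdditive ν.variation ((c • ν).transpose B) (‖B‖ * ‖c‖) := by
    have h := dominatedFinMeasAdditive_cbmApplyMeasure (c • ν) B
    refine ⟨fun s t hs ht hsf htf hd => h.1 s t hs ht (by finiteness) (by finiteness) hd,
      fun s hs hsf => (h.2 s hs (by finiteness)).trans_eq ?_⟩
    rw [hv]
    simp [Measure.real, mul_assoc]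
  have h1 : cintegral f (c • ν) = setToFun ν.variation ((c • ν).transpose B) hcT f := by
    unfold cintegral
    rw [VectorMeasure.integral_eq_setToFun]
    rw! [hv, ← setToFun_congr_smul_measure' _ hcT]
    rfl
  rw [h1]
  change _ = c * setToFun ν.variation (ν.transpose B) hT f
  by_cases hf : Integrable f ν.variation
  · refine Integrable.induction (fun f => setToFun ν.variation ((c • ν).transpose B) hcT f =
      c * setToFun ν.variation (ν.transpose B) hT f) ?_ ?_ ?_ ?_ hf
    · intro x s hs hsf
      rw [setToFun_indicator_const _ hs hsf.ne, setToFun_indicator_const _ hs hsf.ne, hTapp, hTapp,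
        _root_.smul_apply, smul_eq_mul]
      ring
    · intro f g _ hf hg hf' hg'
      rw [setToFun_add _ hf hg, setToFun_add _ hf hg, hf', hg', mul_add]
    · exact isClosed_eq (continuous_setToFun _) (continuous_const.mul (continuous_setToFun _))
    · intro f g hfg _ hf'
      rw [← setToFun_congr_ae _ hfg, ← setToFun_congr_ae _ hfg, hf']
  · rw [setToFun_undef _ hf, setToFun_undef _ hf, mul_zero]

end complexMeasure

/-! ### Operator-valued `n`-measures -/

section operatorMeasure

variable (n : ℕ) (X : Type*) [TopologicalSpace X] [MeasurableSpace X] [BorelSpace X]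
  [MulAction (PU n) X] [ContinuousSMul (PU n) X]
  (H : Type*) [NormedAddCommGroup H] [InnerProductSpace ℂ H] [CompleteSpace H]

/-- An operator-valued `n`-measure on `(X, .)`: a function `E : ℬ(X) → Mₙ(B(H))` whose entries are
weakly countably additive and which satisfies `E (u . A) = u . E A`.  (Mathlib's inner product
`⟪w, h⟫_ℂ` is linear in `h`.) -/
@[ext]
structure OperatorNMeasure where
  toFun : {A : Set X // MeasurableSet A} → Matrix (Fin n) (Fin n) (H →L[ℂ] H)
  isMeasure : ∀ (j k : Fin n) (h w : H), ∃ ν : ComplexMeasure X,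
    ∀ A : {A : Set X // MeasurableSet A}, ν A = ⟪w, toFun A j k h⟫_ℂ
  equivariant : ∀ (u : PU n) (A : Set X) (hA : MeasurableSet A),
    toFun ⟨u • A, hA.const_smul u⟩ = conj u (toFun ⟨A, hA⟩)

variable {n X H}

namespace OperatorNMeasure

variable (E : OperatorNMeasure n X H)

/-- The complex measure `A ↦ ⟨E_{jk}(A) h, w⟩` (linear in `h`, conjugate-linear in `w`). -/
noncomputable def entry (j k : Fin n) (h w : H) : ComplexMeasure X :=
  (E.isMeasure j k h w).choose

lemma entry_apply (j k : Fin n) (h w : H) {A : Set X} (hA : MeasurableSet A) :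
    E.entry j k h w A = ⟪w, E.toFun ⟨A, hA⟩ j k h⟫_ℂ :=
  (E.isMeasure j k h w).choose_spec ⟨A, hA⟩

/-- `E` is regular when all the complex measures `⟨E_{jk}(·) h, w⟩` are regular. -/
def Regular : Prop := ∀ j k h w, IsRegular (E.entry j k h w)

lemma entry_add_left (j k : Fin n) (h h' w : H) :
    E.entry j k (h + h') w = E.entry j k h w + E.entry j k h' w := by
  ext A hA
  simp [entry_apply _ _ _ _ _ hA]

lemma entry_smul_left (j k : Fin n) (c : ℂ) (h w : H) :
    E.entry j k (c • h) w = c • E.entry j k h w := by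
  ext A hA
  simp [entry_apply _ _ _ _ _ hA]

lemma entry_add_right (j k : Fin n) (h w w' : H) :
    E.entry j k h (w + w') = E.entry j k h w + E.entry j k h w' := by
  ext A hA
  simp [entry_apply _ _ _ _ _ hA]

lemma entry_smul_right (j k : Fin n) (c : ℂ) (h w : H) :
    E.entry j k h (c • w) = star c • E.entry j k h w := by
  ext A hA
  simp [entry_apply _ _ _ _ _ hA, mul_comm]

lemma exists_norm_le (j k : Fin n) :
    ∃ C : ℝ≥0, ∀ A : {A : Set X // MeasurableSet A}, ‖E.toFun A j k‖ ≤ C := by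
  have h1 : ∀ h : H, ∃ C, ∀ A : {A : Set X // MeasurableSet A}, ‖E.toFun A j k h‖ ≤ C := by
    intro h
    obtain ⟨C, hC⟩ := banach_steinhaus (g := fun A : {A : Set X // MeasurableSet A} =>
      InnerProductSpace.toDual ℂ H (E.toFun A j k h)) (fun w => by
        refine ⟨(E.entry j k h w).bound, fun A => ?_⟩
        have := (E.entry j k h w).norm_apply_le_bound (s := A)
        rw [entry_apply _ _ _ _ _ A.2, norm_inner_symm] at this
        simpa using this)
    exact ⟨C, fun A => by simpa using hC A⟩
  obtain ⟨C, hC⟩ := banach_steinhaus h1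
  exact ⟨C.toNNReal, fun A => (hC A).trans (Real.le_coe_toNNReal C)⟩

lemma exists_entry_bound (j k : Fin n) :
    ∃ C : ℝ≥0, ∀ h w A, ‖E.entry j k h w A‖ ≤ C * ‖h‖₊ * ‖w‖₊ := by
  obtain ⟨C, hC⟩ := E.exists_norm_le j k
  refine ⟨C, fun h w A => ?_⟩
  by_cases hA : MeasurableSet A
  · rw [entry_apply _ _ _ _ _ hA]
    calc _ ≤ ‖w‖ * ‖E.toFun ⟨A, hA⟩ j k h‖ := norm_inner_le_norm _ _
      _ ≤ ‖w‖ * (C * ‖h‖) := by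
        gcongr
        exact (E.toFun ⟨A, hA⟩ j k).le_of_opNorm_le (hC _) h
      _ = _ := by simp; ring
  · rw [VectorMeasure.not_measurable _ hA, norm_zero]
    positivity

/-- For a bounded Borel `g : X → ℂ`, the sesquilinear form `(w, h) ↦ ∫ g d⟨E_{jk} h, w⟩`. -/
noncomputable def entryForm (j k : Fin n) (g : X → ℂ) (hg : Measurable g)
    (hb : ∃ C : ℝ, ∀ x, ‖g x‖ ≤ C) : H →L⋆[ℂ] H →L[ℂ] ℂ :=
  LinearMap.mkContinuousOfExistsBound₂
    (LinearMap.mk₂'ₛₗ (starRingEnd ℂ) (RingHom.id ℂ)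
      (fun w h => cintegral g (E.entry j k h w))
      (fun w w' h => by
        rw [entry_add_right, cintegral_add_measure _ _ hg hb.choose_spec])
      (fun c w h => by
        rw [entry_smul_right, cintegral_smul_measure]; rfl)
      (fun w h h' => by
        rw [entry_add_left, cintegral_add_measure _ _ hg hb.choose_spec])
      (fun c w h => by
        rw [entry_smul_left, cintegral_smul_measure]; rfl))
    (by
      obtain ⟨M, hM⟩ := hb
      obtain ⟨C, hC⟩ := E.exists_entry_bound j k
      refine ⟨|M| * (4 * C), fun w h => ?_⟩
      have := norm_cintegral_le (E.entry j k h w) (abs_nonneg M)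
        (fun x => (hM x).trans (le_abs_self M)) (C := C * ‖h‖₊ * ‖w‖₊) (fun A => hC h w A)
      refine this.trans_eq ?_
      push_cast
      ring)

/-- The bounded operator `∫ g dE_{jk}`, for a bounded Borel function `g : X → ℂ`; it is determined
by `⟨(∫ g dE_{jk}) h, w⟩ = ∫ g d⟨E_{jk} h, w⟩`, see `inner_entryIntegral`. -/
noncomputable def entryIntegral (j k : Fin n) (g : X → ℂ) (hg : Measurable g)
    (hb : ∃ C : ℝ, ∀ x, ‖g x‖ ≤ C) : H →L[ℂ] H :=
  ContinuousLinearMap.adjoint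
    (InnerProductSpace.continuousLinearMapOfBilin (E.entryForm j k g hg hb))

lemma inner_entryIntegral (j k : Fin n) (g : X → ℂ) (hg : Measurable g)
    (hb : ∃ C : ℝ, ∀ x, ‖g x‖ ≤ C) (h w : H) :
    ⟪w, E.entryIntegral j k g hg hb h⟫_ℂ = cintegral g (E.entry j k h w) := by
  rw [entryIntegral, ContinuousLinearMap.adjoint_inner_right,
    InnerProductSpace.continuousLinearMapOfBilin_apply]
  rfl

/-- The bounded operator `∫ f dE = ∑_{j,k} ∫ f_{jk} dE_{kj}`, for a bounded Borel function
`f : X → Mₙ`. -/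
noncomputable def integral (f : X → Matrix (Fin n) (Fin n) ℂ) (hf : IsBoundedBorel f) :
    H →L[ℂ] H :=
  ∑ j, ∑ k, E.entryIntegral k j (fun x => f x j k) (hf.measurable j k)
    (hf.bounded.imp fun _ hC x => hC x j k)

end OperatorNMeasure

variable (n X H) in
/-- A spectral `n`-measure: a regular operator-valued `n`-measure `E` for which `f ↦ ∫ f dE` is
multiplicative and `*`-preserving on `ℬC*(X, .)`. -/
@[ext]
structure SpectralNMeasure extends OperatorNMeasure n X H where
  regular : toOperatorNMeasure.Regular
  adjoint_integral : ∀ f : BCStar n X,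
    ContinuousLinearMap.adjoint (toOperatorNMeasure.integral f f.2.1) =
      toOperatorNMeasure.integral (star f : BCStar n X) (star f).2.1
  integral_mul : ∀ f g : BCStar n X,
    toOperatorNMeasure.integral (f * g : BCStar n X) (f * g).2.1 =
      toOperatorNMeasure.integral f f.2.1 * toOperatorNMeasure.integral g g.2.1

end operatorMeasure

end NSpace

namespace NSpace

open Filter Topology

/-! ### Calculus of the integral against complex measures -/

section integralCalculus

variable {X : Type*} [MeasurableSpace X]

/-! Everything rests on averaging over the compact group 𝕌ₙ. It acts on C₀(X, Mₙ) by (u·f)(x) =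
u.f(u⁻¹.x), the algebra C*(X, .) is the set of fixed points, and P f = ∫ U·f dU (`average`) is a
bounded projection onto it which sends b*b to some c*c with c in C*(X, .)
(`exists_average_star_mul_self`). Hence π ∘ P extends π to a bounded linear map on C₀(X, Mₙ) that is
positive on squares, although it need not be multiplicative.

Existence. The functional φ ↦ ⟨π(P(φ b*b))h, h⟩ is positive, so the Riesz theorem represents it by a
regular measure. Polarization, and the fact that positive matrices span Mₙ, give regular complex
measures ν_{jk}^{(h,w)} with ⟨π(P f)h, w⟩ = ∑ ∫ f_{jk} dν_{kj}^{(h,w)} for every f in C₀(X, Mₙ).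
Uniqueness in the Riesz theorem makes them sesquilinear and bounded in (h, w), so that they come
from operators E_{jk}(A), and P(u·f) = P f turns into E(u.A) = u.E(A).

Uniqueness. Equivariance of E says that f ↦ ∑ ∫ f_{jk} dν_{kj} is invariant under f ↦ u·f, so it
takes the same value at f and at P f. The integrals over C*(X, .) therefore determine those over
C₀(X, Mₙ), hence the regular measures (`IsInvariant.eq_of_pairing_eq`).

The spectral property uses the same uniqueness principle for matrices of measures. Multiplicativity
of π gives g·ν^{(h,w)} = ν^{(π(g)h,w)} for g in C*(X, .) (`leftDensity_entries`). Integrating a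
Borel f against this yields the product rule with one continuous factor, which in turn gives
ν^{(h,w)}·f = ν^{(h,(∫f dE)*w)} for f in ℬC*(X, .) (`rightDensity_entries`). Integrating a second
Borel function is the full product rule. The adjoint rule comes from (ν^{(w,h)})* = ν^{(h,w)}. -/

lemma norm_cintegral_le_integral_norm (ν : ComplexMeasure X) (f : X → ℂ) :
    ‖cintegral f ν‖ ≤ ∫ x, ‖f x‖ ∂ν.variation := by
  have h := VectorMeasure.norm_integral_le_integral_norm (μ := ν)
    (B := ContinuousLinearMap.mul ℝ ℂ) (f := f)
  have h3 : ‖ContinuousLinearMap.mul ℝ ℂ‖ ≤ 1 := ContinuousLinearMap.opNorm_mul_le ℝ ℂ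
  refine h.trans (mul_le_of_le_one_left ?_ h3)
  positivity

lemma cintegral_add (ν : ComplexMeasure X) {f g : X → ℂ} (hf : Integrable f ν.variation)
    (hg : Integrable g ν.variation) :
    cintegral (f + g) ν = cintegral f ν + cintegral g ν :=
  VectorMeasure.integral_add hf hg

lemma cintegral_finsetSum {ι : Type*} (s : Finset ι) (ν : ComplexMeasure X) {f : ι → X → ℂ}
    (hf : ∀ i ∈ s, Integrable (f i) ν.variation) :
    cintegral (fun x => ∑ i ∈ s, f i x) ν = ∑ i ∈ s, cintegral (f i) ν :=
  VectorMeasure.integral_finsetSum s hf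

lemma cintegral_indicator_const (ν : ComplexMeasure X) {A : Set X} (hA : MeasurableSet A) (c : ℂ) :
    cintegral (A.indicator fun _ => c) ν = c * ν A := by
  unfold cintegral
  rw [VectorMeasure.integral_eq_setToFun, setToFun_indicator_const _ hA (by finiteness)]
  rfl

/-- A continuous additive functional which agrees with a complex measure on indicators is the
integral against that measure. -/
lemma cintegral_eq_of_indicator (ν : ComplexMeasure X) (μ : Measure X) [IsFiniteMeasure μ]
    (hν : ν.variation ≤ μ) (T : (X → ℂ) → ℂ)
    (hadd : ∀ f g, Integrable f μ → Integrable g μ → T (f + g) = T f + T g)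
    (hind : ∀ A, MeasurableSet A → ∀ c, T (A.indicator fun _ => c) = c * ν A)
    {C : ℝ≥0} (hC : ∀ f, Integrable f μ → ‖T f‖ ≤ C * ∫ x, ‖f x‖ ∂μ)
    {f : X → ℂ} (hf : Integrable f μ) : cintegral f ν = T f := by
  have hsub : ∀ f g, Integrable f μ → Integrable g μ → T f - T g = T (f - g) := by
    intro f g hf hg
    have := hadd (f - g) g (hf.sub hg) hg
    rw [sub_add_cancel] at this
    rw [this, add_sub_cancel_right]
  have key : ∀ f g, Integrable f μ → Integrable g μ → ‖T f - T g‖ ≤ C * ∫ x, ‖f x - g x‖ ∂μ := by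
    intro f g hf hg
    rw [hsub f g hf hg]
    exact hC _ (hf.sub hg)
  have key' : ∀ f g, Integrable f μ → Integrable g μ →
      ‖cintegral f ν - cintegral g ν‖ ≤ 1 * ∫ x, ‖f x - g x‖ ∂μ := by
    intro f g hf hg
    have h1 : cintegral (f - g) ν = cintegral f ν - cintegral g ν :=
      VectorMeasure.integral_sub (hf.mono_measure hν) (hg.mono_measure hν)
    rw [← h1, one_mul]
    refine (norm_cintegral_le_integral_norm _ _).trans ?_
    exact integral_mono_measure hν (ae_of_all _ fun _ => norm_nonneg _) (hf.sub hg).norm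
  refine Integrable.induction (fun f => cintegral f ν = T f) ?_ ?_ ?_ ?_ hf
  · intro c s hs _
    rw [cintegral_indicator_const _ hs, hind s hs]
  · intro f g _ hf hg hf' hg'
    rw [hadd f g hf hg, cintegral_add _ (hf.mono_measure hν) (hg.mono_measure hν), hf', hg']
  · refine isClosed_eq ?_ ?_
    · refine (LipschitzWith.of_dist_le_mul (K := 1) fun f g => ?_).continuous
      rw [dist_eq_norm, L1.dist_eq_integral_dist]
      simpa [dist_eq_norm] using key' f g (L1.integrable_coeFn f) (L1.integrable_coeFn g)
    · refine (LipschitzWith.of_dist_le_mul (K := C) fun f g => ?_).continuous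
      rw [dist_eq_norm, L1.dist_eq_integral_dist]
      simpa [dist_eq_norm] using key f g (L1.integrable_coeFn f) (L1.integrable_coeFn g)
  -- `T` is not assumed to respect almost everywhere equality; its L¹ bound forces this.
  · intro f g hfg hf h
    have hg : Integrable g μ := hf.congr hfg
    have h0 : ∫ x, ‖f x - g x‖ ∂μ = 0 := by
      refine (integral_congr_ae (g := 0) ?_).trans (integral_zero' _ _)
      filter_upwards [hfg] with x hx
      simp [hx]
    have h1 := key f g hf hg
    have h2 := key' f g hf hg
    rw [h0, mul_zero, norm_le_zero_iff, sub_eq_zero] at h1 h2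
    rw [← h1, ← h2, h]

lemma integrable_of_bounded_measurable (μ : Measure X) [IsFiniteMeasure μ] {f : X → ℂ}
    (hf : Measurable f) (hb : ∃ C : ℝ, ∀ x, ‖f x‖ ≤ C) : Integrable f μ :=
  Integrable.of_bound hf.aestronglyMeasurable _ (ae_of_all _ hb.choose_spec)

lemma cintegral_const_mul (c : ℂ) (ν : ComplexMeasure X) {f : X → ℂ}
    (hf : Integrable f ν.variation) :
    cintegral (fun x => c * f x) ν = c * cintegral f ν := by
  have hv : (c • ν).variation = ‖c‖₊ • ν.variation := VectorMeasure.variation_smul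
  have hμ : IsFiniteMeasure (ν.variation + (c • ν).variation) := inferInstance
  have hf' : Integrable f (ν.variation + (c • ν).variation) := by
    refine hf.add_measure ?_
    rw [hv]
    exact hf.smul_measure_nnreal
  -- The scalar is moved to the measure, and f ↦ ∫ c f dν is compared with integration against c ν
  -- on indicators. The sum of the two variations serves as a common dominating measure.
  rw [← cintegral_smul_measure]
  refine (cintegral_eq_of_indicator (c • ν) (ν.variation + (c • ν).variation)
    (Measure.le_add_left le_rfl)
    (fun f => cintegral (fun x => c * f x) ν) ?_ ?_ (C := ‖c‖₊) ?_ hf').symm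
  · intro f g hf hg
    rw [← cintegral_add _ (hf.left_of_add_measure.const_mul c)
      (hg.left_of_add_measure.const_mul c)]
    congr 1
    ext x
    simp [mul_add]
  · intro A hA d
    have : (fun x => c * A.indicator (fun _ => d) x) = A.indicator fun _ => c * d := by
      ext x
      by_cases hx : x ∈ A <;> simp [hx]
    rw [this, cintegral_indicator_const _ hA, _root_.smul_apply, smul_eq_mul]
    ring
  · intro f hf
    refine (norm_cintegral_le_integral_norm _ _).trans ?_
    simp_rw [norm_mul, integral_const_mul]
    simp only [coe_nnnorm]
    gcongr
    · exact ae_of_all _ fun _ => norm_nonneg _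
    · exact hf.norm
    · exact Measure.le_add_right le_rfl

lemma cintegral_add_measure_of_bounded (μ ν : ComplexMeasure X) {f : X → ℂ} (hf : Measurable f)
    (hb : ∃ C : ℝ, ∀ x, ‖f x‖ ≤ C) : cintegral f (μ + ν) = cintegral f μ + cintegral f ν :=
  cintegral_add_measure μ ν hf hb.choose_spec

lemma cintegral_zero_measure (f : X → ℂ) : cintegral f (0 : ComplexMeasure X) = 0 :=
  VectorMeasure.integral_zero_vectorMeasure

lemma cintegral_finsetSum_measure {ι : Type*} (s : Finset ι) (ν : ι → ComplexMeasure X)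
    {f : X → ℂ} (hf : Measurable f) (hb : ∃ C : ℝ, ∀ x, ‖f x‖ ≤ C) :
    cintegral f (∑ i ∈ s, ν i) = ∑ i ∈ s, cintegral f (ν i) := by
  classical
  induction s using Finset.induction_on with
  | empty => simp [cintegral_zero_measure]
  | insert a s ha ih =>
    rw [Finset.sum_insert ha, Finset.sum_insert ha, cintegral_add_measure_of_bounded _ _ hf hb, ih]

/-- The complex conjugate of a complex measure. -/
noncomputable def conjMeasure (ν : ComplexMeasure X) : ComplexMeasure X :=
  VectorMeasure.mapRange ν (starRingEnd ℂ : ℂ →+* ℂ).toAddMonoidHom Complex.continuous_conj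

lemma conjMeasure_apply (ν : ComplexMeasure X) (A : Set X) :
    conjMeasure ν A = starRingEnd ℂ (ν A) := rfl

lemma cintegral_conjMeasure (ν : ComplexMeasure X) {f : X → ℂ} (hf : Measurable f)
    (hb : ∃ C : ℝ, ∀ x, ‖f x‖ ≤ C) :
    cintegral f (conjMeasure ν) = starRingEnd ℂ (cintegral (fun x => starRingEnd ℂ (f x)) ν) := by
  refine cintegral_eq_of_indicator (conjMeasure ν) (ν.variation + (conjMeasure ν).variation)
    (Measure.le_add_left le_rfl)
    (fun f => starRingEnd ℂ (cintegral (fun x => starRingEnd ℂ (f x)) ν)) ?_ ?_ (C := 1) ?_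
    (integrable_of_bounded_measurable _ hf hb)
  · intro f g hf hg
    have hc : ∀ {f : X → ℂ}, Integrable f (ν.variation + (conjMeasure ν).variation) →
        Integrable (fun x => starRingEnd ℂ (f x)) ν.variation := fun hf =>
      (Complex.conjCLE : ℂ →L[ℝ] ℂ).integrable_comp hf.left_of_add_measure
    rw [← map_add, ← cintegral_add _ (hc hf) (hc hg)]
    congr 2
    ext x
    simp
  · intro A hA d
    have : (fun x => starRingEnd ℂ (A.indicator (fun _ => d) x)) =
        A.indicator fun _ => starRingEnd ℂ d := by
      ext x
      by_cases hx : x ∈ A <;> simp [hx]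
    rw [this, cintegral_indicator_const _ hA, conjMeasure_apply]
    simp
  · intro f hf
    rw [RCLike.norm_conj]
    refine (norm_cintegral_le_integral_norm _ _).trans ?_
    simp_rw [RCLike.norm_conj]
    rw [NNReal.coe_one, one_mul]
    gcongr
    · exact ae_of_all _ fun _ => norm_nonneg _
    · exact hf.norm
    · exact Measure.le_add_right le_rfl

/-- The complex measure `g ν`, for a bounded Borel function `g`. -/
noncomputable def densityMeasure (g : X → ℂ) (ν : ComplexMeasure X) : ComplexMeasure X :=
  VectorMeasure.withDensity ν g (ContinuousLinearMap.mul ℝ ℂ)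

lemma densityMeasure_apply {g : X → ℂ} (ν : ComplexMeasure X) (hg : Measurable g)
    (hb : ∃ C : ℝ, ∀ x, ‖g x‖ ≤ C) {A : Set X} (hA : MeasurableSet A) :
    densityMeasure g ν A = cintegral (A.indicator g) ν := by
  unfold densityMeasure cintegral
  rw [VectorMeasure.withDensity_apply (integrable_of_bounded_measurable _ hg hb),
    VectorMeasure.integral_indicator hA]

lemma integrable_mul_of_bounded (μ : Measure X) {f g : X → ℂ} (hf : Integrable f μ)
    (hg : Measurable g) (hb : ∃ C : ℝ, ∀ x, ‖g x‖ ≤ C) : Integrable (fun x => f x * g x) μ := by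
  obtain ⟨C, hC⟩ := hb
  exact hf.mul_bdd hg.aestronglyMeasurable (ae_of_all _ hC)

/-- From |∫_A g dν| ≤ C |ν|(A). Domination by a multiple of |ν| is what makes g ν inherit
regularity. -/
lemma variation_densityMeasure_le {g : X → ℂ} (ν : ComplexMeasure X) (hg : Measurable g)
    {C : ℝ≥0} (hC : ∀ x, ‖g x‖ ≤ C) : (densityMeasure g ν).variation ≤ C • ν.variation := by
  refine VectorMeasure.variation_le_of_forall_enorm_le fun A hA => ?_
  rw [densityMeasure_apply ν hg ⟨C, hC⟩ hA]
  have h1 := norm_cintegral_le_integral_norm ν (A.indicator g)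
  have h2 : ∫ x, ‖A.indicator g x‖ ∂ν.variation ≤ C * ν.variation.real A := by
    calc ∫ x, ‖A.indicator g x‖ ∂ν.variation ≤ ∫ x, A.indicator (fun _ => (C : ℝ)) x ∂ν.variation := by
          refine integral_mono_of_nonneg (ae_of_all _ fun _ => norm_nonneg _)
            ((integrable_const _).indicator hA) (ae_of_all _ fun x => ?_)
          by_cases hx : x ∈ A <;> simp [hx, hC x]
      _ = C * ν.variation.real A := by
          rw [integral_indicator_const _ hA, smul_eq_mul, mul_comm]
  rw [← ofReal_norm, Measure.smul_apply, ENNReal.smul_def, smul_eq_mul]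
  refine (ENNReal.ofReal_le_ofReal (h1.trans h2)).trans_eq ?_
  rw [ENNReal.ofReal_mul (by positivity), ENNReal.ofReal_coe_nnreal, ofReal_measureReal]

lemma cintegral_densityMeasure {g : X → ℂ} (ν : ComplexMeasure X) (hg : Measurable g)
    (hb : ∃ C : ℝ, ∀ x, ‖g x‖ ≤ C) {f : X → ℂ} (hf : Measurable f)
    (hfb : ∃ C : ℝ, ∀ x, ‖f x‖ ≤ C) :
    cintegral f (densityMeasure g ν) = cintegral (fun x => f x * g x) ν := by
  obtain ⟨C, hC⟩ := id hb
  have hC' : ∀ x, ‖g x‖ ≤ C.toNNReal := fun x => (hC x).trans (Real.le_coe_toNNReal C)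
  refine cintegral_eq_of_indicator (densityMeasure g ν)
    (ν.variation + (densityMeasure g ν).variation) (Measure.le_add_left le_rfl)
    (fun f => cintegral (fun x => f x * g x) ν) ?_ ?_ (C := C.toNNReal) ?_
    (integrable_of_bounded_measurable _ hf hfb)
  · intro f₁ f₂ hf₁ hf₂
    rw [← cintegral_add _ (integrable_mul_of_bounded _ hf₁.left_of_add_measure hg hb)
      (integrable_mul_of_bounded _ hf₂.left_of_add_measure hg hb)]
    congr 1
    ext x
    simp [add_mul]
  · intro A hA c
    have h1 : (fun x => A.indicator (fun _ => c) x * g x) = fun x => c * A.indicator g x := by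
      ext x
      by_cases hx : x ∈ A <;> simp [hx]
    rw [h1, cintegral_const_mul _ _
      ((integrable_of_bounded_measurable _ hg hb).indicator hA), densityMeasure_apply ν hg hb hA]
  · intro f hf
    refine (norm_cintegral_le_integral_norm _ _).trans ?_
    rw [← integral_const_mul]
    have hi := (integrable_mul_of_bounded _ hf.left_of_add_measure hg hb).norm
    calc ∫ x, ‖f x * g x‖ ∂ν.variation ≤ ∫ x, C.toNNReal * ‖f x‖ ∂ν.variation := by
          refine integral_mono hi (hf.left_of_add_measure.norm.const_mul _) fun x => ?_
          simp only [norm_mul]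
          rw [mul_comm]
          exact mul_le_mul_of_nonneg_right (hC' x) (norm_nonneg _)
      _ ≤ _ := by
          refine integral_mono_measure (Measure.le_add_right le_rfl)
            (ae_of_all _ fun _ => by positivity) (hf.norm.const_mul _)

/-- A finite positive measure, as a complex measure. -/
noncomputable def ofMeasure (μ : Measure X) [IsFiniteMeasure μ] : ComplexMeasure X :=
  VectorMeasure.mapRange μ.toSignedMeasure Complex.ofRealHom.toAddMonoidHom
    Complex.continuous_ofReal

lemma ofMeasure_apply (μ : Measure X) [IsFiniteMeasure μ] {A : Set X} (hA : MeasurableSet A) :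
    ofMeasure μ A = (μ.real A : ℂ) := by
  change ((μ.toSignedMeasure A : ℝ) : ℂ) = _
  rw [Measure.toSignedMeasure_apply_measurable hA]

lemma variation_ofMeasure_le (μ : Measure X) [IsFiniteMeasure μ] :
    (ofMeasure μ).variation ≤ μ := by
  refine VectorMeasure.variation_le_of_forall_enorm_le fun A hA => ?_
  rw [ofMeasure_apply μ hA, ← ofReal_norm, Complex.norm_real, Real.norm_of_nonneg measureReal_nonneg,
    ofReal_measureReal]

lemma cintegral_ofMeasure (μ : Measure X) [IsFiniteMeasure μ] {f : X → ℂ} (hf : Integrable f μ) :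
    cintegral f (ofMeasure μ) = ∫ x, f x ∂μ := by
  refine cintegral_eq_of_indicator (ofMeasure μ) μ (variation_ofMeasure_le μ)
    (fun f => ∫ x, f x ∂μ) (fun f g hf hg => integral_add hf hg) ?_ (C := 1) ?_ hf
  · intro A hA c
    rw [integral_indicator_const _ hA, ofMeasure_apply μ hA, Complex.real_smul, mul_comm]
  · intro f _
    simpa using norm_integral_le_integral_norm f

end integralCalculus

end NSpace

namespace NSpace

open Filter Topology
open scoped CompactlySupported

/-! ### Regular complex measures -/

section regularity

variable {X : Type*} [TopologicalSpace X] [T2Space X] [MeasurableSpace X] [BorelSpace X]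

/-- A compact K ⊆ A with μ(A \ K) small also has |ν|(A \ K) small, so inner regularity passes down
to |ν|; for a finite Borel measure this yields regularity. Each closure property of regular measures
below thus reduces to a bound on the variation. -/
lemma isRegular_of_variation_le {ν : ComplexMeasure X} {μ : Measure X} [IsFiniteMeasure μ]
    [μ.Regular] (h : ν.variation ≤ μ) : IsRegular ν := by
  have : ν.variation.InnerRegular := by
    refine ⟨fun A hA r hr => ?_⟩
    have hpos : ν.variation A - r ≠ 0 := (tsub_pos_of_lt hr).ne'
    obtain ⟨K, hKA, hK, hlt⟩ := hA.exists_isCompact_sdiff_lt (measure_ne_top μ A) hpos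
    refine ⟨K, hKA, hK, ?_⟩
    by_contra hle
    have h1 : ν.variation A ≤ ν.variation K + ν.variation (A \ K) := by
      rw [measure_add_sdiff hK.measurableSet.nullMeasurableSet, Set.union_eq_self_of_subset_left hKA]
    have h2 : ν.variation (A \ K) < ν.variation A - r := (h _).trans_lt hlt
    have h3 : ν.variation K + ν.variation (A \ K) < r + (ν.variation A - r) :=
      ENNReal.add_lt_add_of_le_of_lt (by finiteness) (not_lt.1 hle) h2
    rw [add_tsub_cancel_of_le hr.le] at h3
    exact absurd h1 (not_le.2 h3)
  unfold IsRegular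
  infer_instance

lemma IsRegular.add {μ ν : ComplexMeasure X} (hμ : IsRegular μ) (hν : IsRegular ν) :
    IsRegular (μ + ν) := by
  have h1 : μ.variation.Regular := hμ
  have h2 : ν.variation.Regular := hν
  exact isRegular_of_variation_le VectorMeasure.variation_add_le

lemma IsRegular.smul {ν : ComplexMeasure X} (hν : IsRegular ν) (c : ℂ) : IsRegular (c • ν) := by
  have h1 : ν.variation.Regular := hν
  have h2 : (c • ν).variation = ‖c‖₊ • ν.variation := VectorMeasure.variation_smul
  exact isRegular_of_variation_le h2.le

lemma isRegular_zero : IsRegular (0 : ComplexMeasure X) := by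
  have : (0 : ComplexMeasure X).variation = 0 := VectorMeasure.variation_zero
  unfold IsRegular
  rw [this]
  infer_instance

lemma IsRegular.finsetSum {ι : Type*} (s : Finset ι) {ν : ι → ComplexMeasure X}
    (hν : ∀ i ∈ s, IsRegular (ν i)) : IsRegular (∑ i ∈ s, ν i) :=
  Finset.sum_induction _ IsRegular (fun _ _ => IsRegular.add) isRegular_zero hν

lemma IsRegular.map {ν : ComplexMeasure X} (hν : IsRegular ν) (e : X ≃ₜ X) :
    IsRegular (ν.map e) := by
  have h1 : ν.variation.Regular := hν
  have h2 : (ν.variation.map e).Regular := Measure.Regular.map e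
  exact isRegular_of_variation_le VectorMeasure.variation_map_le

lemma IsRegular.conjMeasure {ν : ComplexMeasure X} (hν : IsRegular ν) :
    IsRegular (conjMeasure ν) := by
  have h1 : ν.variation.Regular := hν
  refine isRegular_of_variation_le (VectorMeasure.variation_le_of_forall_enorm_le
    (m := ν.variation) fun A _ => ?_)
  rw [conjMeasure_apply]
  refine le_trans (le_of_eq ?_) (VectorMeasure.enorm_measure_le_variation ν A)
  rw [← ofReal_norm, ← ofReal_norm, RCLike.norm_conj]

lemma IsRegular.densityMeasure {ν : ComplexMeasure X} (hν : IsRegular ν) {g : X → ℂ}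
    (hg : Measurable g) (hb : ∃ C : ℝ, ∀ x, ‖g x‖ ≤ C) : IsRegular (densityMeasure g ν) := by
  have h1 : ν.variation.Regular := hν
  obtain ⟨C, hC⟩ := hb
  exact isRegular_of_variation_le (variation_densityMeasure_le ν hg (C := C.toNNReal)
    fun x => (hC x).trans (Real.le_coe_toNNReal C))

/-! ### Approximation by compactly supported functions and the Riesz representation theorem. -/

variable [LocallyCompactSpace X]

/-- A real continuous function with compact support, as a complex function vanishing at infinity. -/
noncomputable def realToZeroAtInfty : C_c(X, ℝ) →ₗ[ℝ] C₀(X, ℂ) where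
  toFun φ :=
    { toFun := fun x => (φ x : ℂ)
      continuous_toFun := Complex.continuous_ofReal.comp φ.continuous
      zero_at_infty' := by
        have := (Complex.continuous_ofReal.tendsto 0).comp
          (HasCompactSupport.is_zero_at_infty φ.hasCompactSupport)
        exact_mod_cast this }
  map_add' φ ψ := by
    ext x
    simp
  map_smul' c φ := by
    ext x
    simp

omit [T2Space X] [MeasurableSpace X] [BorelSpace X] [LocallyCompactSpace X] in
@[simp]
lemma realToZeroAtInfty_apply (φ : C_c(X, ℝ)) (x : X) : realToZeroAtInfty φ x = (φ x : ℂ) := rfl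

lemma integrable_zeroAtInfty (μ : Measure X) [IsFiniteMeasure μ] (φ : C₀(X, ℂ)) :
    Integrable φ μ :=
  integrable_of_bounded_measurable μ (map_continuous φ).measurable
    ⟨‖φ.toBCF‖, fun x => φ.toBCF.norm_coe_le_norm x⟩

/-- Take K compact inside A and V open around K with |ν|(A \ K) and |ν|(V \ K) at most ε/2. A
Urysohn function equal to 1 on K and 0 off V differs from the indicator of A only on (A \ K) ∪ (V \
K), and there by at most 1. -/
lemma IsRegular.exists_norm_sub_cintegral_le {ν : ComplexMeasure X} (hν : IsRegular ν) {A : Set X}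
    (hA : MeasurableSet A) {ε : ℝ} (hε : 0 < ε) :
    ∃ φ : C_c(X, ℝ), (∀ x, φ x ∈ Set.Icc (0 : ℝ) 1) ∧
      ‖ν A - cintegral (realToZeroAtInfty φ) ν‖ ≤ ε := by
  have h1 : ν.variation.Regular := hν
  have hε2 : ENNReal.ofReal (ε / 2) ≠ 0 := by simpa using hε
  obtain ⟨K, hKA, hK, hKε⟩ := hA.exists_isCompact_sdiff_lt (measure_ne_top ν.variation A) hε2
  obtain ⟨V, hKV, hV, hVε⟩ := hK.exists_isOpen_lt_add (μ := ν.variation) hε2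
  obtain ⟨χ, hχK, hχV, hχs, hχ⟩ := exists_continuous_one_zero_of_isCompact hK hV.isClosed_compl
    (Set.disjoint_compl_right_iff_subset.2 hKV)
  have hVK : ν.variation (V \ K) ≤ ENNReal.ofReal (ε / 2) :=
    (measure_sdiff_lt_of_lt_add hK.measurableSet.nullMeasurableSet hKV (by finiteness) hVε).le
  let φ : C_c(X, ℝ) := ⟨χ, hχs⟩
  refine ⟨φ, hχ, ?_⟩
  have h2 : ν A = cintegral (A.indicator fun _ => (1 : ℂ)) ν := by
    rw [cintegral_indicator_const _ hA, one_mul]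
  have hi : Integrable (A.indicator fun _ => (1 : ℂ)) ν.variation :=
    (integrable_const _).indicator hA
  have h3 : cintegral ((A.indicator fun _ => (1 : ℂ)) - ⇑(realToZeroAtInfty φ)) ν =
      cintegral (A.indicator fun _ => (1 : ℂ)) ν - cintegral (realToZeroAtInfty φ) ν :=
    VectorMeasure.integral_sub hi (integrable_zeroAtInfty _ _)
  have hS : MeasurableSet (A \ K ∪ V \ K) :=
    (hA.diff hK.measurableSet).union (hV.measurableSet.diff hK.measurableSet)
  have hSε : ν.variation.real (A \ K ∪ V \ K) ≤ ε := by
    refine ENNReal.toReal_le_of_le_ofReal hε.le ((measure_union_le _ _).trans ?_)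
    refine (add_le_add hKε.le hVK).trans_eq ?_
    rw [← ENNReal.ofReal_add (by positivity) (by positivity), add_halves]
  rw [h2, ← h3]
  refine (norm_cintegral_le_integral_norm _ _).trans (le_trans ?_ hSε)
  rw [← mul_one (ν.variation.real _), ← smul_eq_mul, ← integral_indicator_const _ hS]
  refine integral_mono (hi.sub (integrable_zeroAtInfty _ _)).norm
    ((integrable_const _).indicator hS) fun x => ?_
  have h4 : A.indicator (fun _ => (1 : ℂ)) x = ((A.indicator (fun _ => (1 : ℝ)) x : ℝ) : ℂ) := by
    by_cases hx : x ∈ A <;> simp [hx]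
  have h5 : realToZeroAtInfty φ x = (χ x : ℂ) := rfl
  have h6 := hχ x
  simp only [Pi.sub_apply]
  rw [h4, h5, ← Complex.ofReal_sub, Complex.norm_real, Real.norm_eq_abs]
  by_cases hxK : x ∈ K
  · simp [hχK hxK, hKA hxK, hxK]
  · by_cases hxA : x ∈ A
    · rw [Set.indicator_of_mem hxA, Set.indicator_of_mem (s := A \ K ∪ V \ K) (Or.inl ⟨hxA, hxK⟩), abs_le]
      exact ⟨by linarith [h6.2], by linarith [h6.1]⟩
    · by_cases hxV : x ∈ V
      · rw [Set.indicator_of_notMem hxA, Set.indicator_of_mem (s := A \ K ∪ V \ K) (Or.inr ⟨hxV, hxK⟩), abs_le]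
        exact ⟨by linarith [h6.2], by linarith [h6.1]⟩
      · simp [hχV hxV, hxK, hxA, hxV]

/-- Each ν(A) is a limit of integrals of functions of norm at most 1. The case C = 0 gives
uniqueness in the Riesz theorem; the general case bounds the coefficient measures uniformly in A. -/
lemma IsRegular.norm_le {ν : ComplexMeasure X} (hν : IsRegular ν) {C : ℝ}
    (h : ∀ φ : C₀(X, ℂ), ‖cintegral φ ν‖ ≤ C * ‖φ‖) (hC : 0 ≤ C) (A : Set X) : ‖ν A‖ ≤ C := by
  by_cases hA : MeasurableSet A
  · refine le_of_forall_pos_le_add fun ε hε => ?_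
    obtain ⟨φ, hφ, hφ'⟩ := hν.exists_norm_sub_cintegral_le hA hε
    have h1 : ‖realToZeroAtInfty φ‖ ≤ 1 := by
      rw [← ZeroAtInftyContinuousMap.norm_toBCF_eq_norm,
        BoundedContinuousFunction.norm_le zero_le_one]
      intro x
      change ‖(φ x : ℂ)‖ ≤ 1
      rw [Complex.norm_real, Real.norm_of_nonneg (hφ x).1]
      exact (hφ x).2
    calc ‖ν A‖ ≤ ‖cintegral (realToZeroAtInfty φ) ν‖ +
          ‖ν A - cintegral (realToZeroAtInfty φ) ν‖ := norm_le_norm_add_norm_sub' _ _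
      _ ≤ C * ‖realToZeroAtInfty φ‖ + ε := add_le_add (h _) hφ'
      _ ≤ C + ε := by
        gcongr
        exact mul_le_of_le_one_right hC h1
  · rwa [VectorMeasure.not_measurable _ hA, norm_zero]

lemma IsRegular.eq_of_cintegral_eq {μ ν : ComplexMeasure X} (hμ : IsRegular μ) (hν : IsRegular ν)
    (h : ∀ φ : C₀(X, ℂ), cintegral φ μ = cintegral φ ν) : μ = ν := by
  have hr : IsRegular (μ + (-1 : ℂ) • ν) := hμ.add (hν.smul _)
  have h0 : ∀ A, ‖(μ + (-1 : ℂ) • ν) A‖ ≤ 0 := hr.norm_le (fun φ => by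
    rw [cintegral_add_measure_of_bounded _ _ (map_continuous φ).measurable
      ⟨‖φ.toBCF‖, fun x => φ.toBCF.norm_coe_le_norm x⟩, cintegral_smul_measure, h]
    simp) le_rfl
  ext A _
  have := norm_le_zero_iff.1 (h0 A)
  rw [_root_.add_apply, _root_.smul_apply] at this
  simpa [add_neg_eq_zero] using this

omit [T2Space X] [MeasurableSpace X] [BorelSpace X] in
-- A cutoff χ equal to 1 on a compact set outside which |φ| < ε leaves the error (1 - χ)φ. The
-- witnesses are the real and imaginary parts of χφ.
lemma exists_dist_realToZeroAtInfty_lt [T2Space X] (φ : C₀(X, ℂ)) {ε : ℝ} (hε : 0 < ε) :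
    ∃ ψ₁ ψ₂ : C_c(X, ℝ),
      ‖φ - (realToZeroAtInfty ψ₁ + Complex.I • realToZeroAtInfty ψ₂)‖ ≤ ε := by
  have h1 : ∀ᶠ x in cocompact X, ‖φ x‖ < ε := by
    have := (zero_at_infty φ).norm
    rw [norm_zero] at this
    exact this.eventually_lt_const hε
  obtain ⟨K, hK, hKε⟩ := mem_cocompact.1 h1
  obtain ⟨χ, hχK, -, hχs, hχ⟩ := exists_continuous_one_zero_of_isCompact hK isClosed_empty
    (Set.disjoint_empty K)
  refine ⟨⟨⟨fun x => χ x * (φ x).re, by fun_prop⟩, hχs.mul_right⟩,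
    ⟨⟨fun x => χ x * (φ x).im, by fun_prop⟩, hχs.mul_right⟩, ?_⟩
  rw [← ZeroAtInftyContinuousMap.norm_toBCF_eq_norm, BoundedContinuousFunction.norm_le hε.le]
  intro x
  change ‖φ x - (((χ x * (φ x).re : ℝ) : ℂ) + Complex.I * ((χ x * (φ x).im : ℝ) : ℂ))‖ ≤ ε
  have h2 : φ x - (((χ x * (φ x).re : ℝ) : ℂ) + Complex.I * ((χ x * (φ x).im : ℝ) : ℂ)) =
      ((1 - χ x : ℝ) : ℂ) * φ x := by
    apply Complex.ext <;> simp <;> ring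
  rw [h2, norm_mul, Complex.norm_real, Real.norm_of_nonneg (by linarith [(hχ x).2])]
  by_cases hx : x ∈ K
  · rw [hχK hx]
    simpa using hε.le
  · have h3 : ‖φ x‖ < ε := hKε hx
    nlinarith [(hχ x).1, norm_nonneg (φ x)]

lemma continuous_cintegral_zeroAtInfty (ν : ComplexMeasure X) :
    Continuous fun φ : C₀(X, ℂ) => cintegral φ ν := by
  refine (LipschitzWith.of_dist_le_mul (K := (ν.variation.real Set.univ).toNNReal)
    fun φ ψ => ?_).continuous
  have h1 : cintegral (φ - ψ) ν = cintegral φ ν - cintegral ψ ν :=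
    VectorMeasure.integral_sub (integrable_zeroAtInfty _ _) (integrable_zeroAtInfty _ _)
  rw [dist_eq_norm, ← h1, dist_eq_norm, Real.coe_toNNReal _ measureReal_nonneg]
  refine (norm_cintegral_le_integral_norm _ _).trans ?_
  have h2 : ∀ x, ‖(⇑φ - ⇑ψ) x‖ ≤ ‖φ - ψ‖ := fun x => (φ - ψ).toBCF.norm_coe_le_norm x
  calc ∫ x, ‖(⇑φ - ⇑ψ) x‖ ∂ν.variation ≤ ∫ _, ‖φ - ψ‖ ∂ν.variation :=
        integral_mono ((integrable_zeroAtInfty _ _).sub (integrable_zeroAtInfty _ _)).norm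
          (integrable_const _) h2
    _ = _ := by simp

/-- The Riesz representation theorem for a bounded positive functional on `C₀(X, ℂ)`. -/
lemma exists_regular_cintegral_of_nonneg (L : C₀(X, ℂ) →L[ℂ] ℂ)
    (hL : ∀ φ : C_c(X, ℝ), (∀ x, 0 ≤ φ x) → ∃ r : ℝ, 0 ≤ r ∧ L (realToZeroAtInfty φ) = r) :
    ∃ ν : ComplexMeasure X, IsRegular ν ∧ ∀ φ : C₀(X, ℂ), L φ = cintegral φ ν := by
  let Λ : C_c(X, ℝ) →ₚ[ℝ] ℝ := PositiveLinearMap.mk₀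
    (Complex.reLm ∘ₗ (L : C₀(X, ℂ) →ₗ[ℂ] ℂ).restrictScalars ℝ ∘ₗ realToZeroAtInfty) (by
      intro φ hφ
      obtain ⟨r, hr, hr'⟩ := hL φ hφ
      simpa [hr'] using hr)
  have hΛ : ∀ φ, Λ φ = (L (realToZeroAtInfty φ)).re := fun _ => rfl
  have hreal : ∀ φ : C_c(X, ℝ), L (realToZeroAtInfty φ) = (Λ φ : ℂ) := by
    have hpos : ∀ φ : C_c(X, ℝ), (∀ x, 0 ≤ φ x) → L (realToZeroAtInfty φ) = (Λ φ : ℂ) := by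
      intro φ hφ
      obtain ⟨r, -, hr'⟩ := hL φ hφ
      rw [hΛ, hr', Complex.ofReal_re]
    intro φ
    -- Positive and negative parts: `L` is real on nonnegative functions, hence on their
    -- differences.
    have hdec : ∃ φ₁ φ₂ : C_c(X, ℝ), (∀ x, 0 ≤ φ₁ x) ∧ (∀ x, 0 ≤ φ₂ x) ∧ φ = φ₁ - φ₂ := by
      refine ⟨⟨⟨fun x => max 0 (φ x), by fun_prop⟩,
          φ.hasCompactSupport.comp_left (g := fun t : ℝ => max 0 t) (by simp)⟩,
        ⟨⟨fun x => max 0 (-φ x), by fun_prop⟩,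
          φ.hasCompactSupport.comp_left (g := fun t : ℝ => max 0 (-t)) (by simp)⟩,
        fun x => le_max_left _ _, fun x => le_max_left _ _, ?_⟩
      ext x
      change φ x = max 0 (φ x) - max 0 (-φ x)
      grind
    obtain ⟨φ₁, φ₂, h1, h2, rfl⟩ := hdec
    rw [map_sub, map_sub, map_sub, hpos _ h1, hpos _ h2, Complex.ofReal_sub]
  let μ := RealRMK.rieszMeasure Λ
  -- The total mass is the supremum of μ(K) over compact K, and a cutoff χ equal to 1 on K gives
  -- μ(K) ≤ Λ χ ≤ ‖L‖.
  have hμ : IsFiniteMeasure μ := by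
    refine ⟨lt_of_le_of_lt ?_ (ENNReal.ofReal_lt_top (r := ‖L‖))⟩
    rw [isOpen_univ.measure_eq_iSup_isCompact]
    refine iSup₂_le fun K _ => iSup_le fun hK => ?_
    obtain ⟨χ, hχK, -, hχs, hχ⟩ := exists_continuous_one_zero_of_isCompact hK isClosed_empty
      (Set.disjoint_empty K)
    refine (RealRMK.rieszMeasure_le_of_eq_one Λ (f := ⟨χ, hχs⟩) (fun x => (hχ x).1) hK
      fun x hx => hχK hx).trans (ENNReal.ofReal_le_ofReal ?_)
    rw [hΛ]
    refine (Complex.re_le_norm _).trans ((L.le_opNorm _).trans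
      (mul_le_of_le_one_right (norm_nonneg _) ?_))
    rw [← ZeroAtInftyContinuousMap.norm_toBCF_eq_norm,
      BoundedContinuousFunction.norm_le zero_le_one]
    intro x
    change ‖(χ x : ℂ)‖ ≤ 1
    rw [Complex.norm_real, Real.norm_of_nonneg (hχ x).1]
    exact (hχ x).2
  refine ⟨ofMeasure μ, isRegular_of_variation_le (variation_ofMeasure_le μ), ?_⟩
  have h1 : ∀ φ : C_c(X, ℝ), L (realToZeroAtInfty φ) =
      cintegral (realToZeroAtInfty φ) (ofMeasure μ) := by
    intro φ
    rw [cintegral_ofMeasure _ (integrable_zeroAtInfty _ _), hreal,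
      ← RealRMK.integral_rieszMeasure Λ φ]
    exact integral_ofReal.symm
  have hadd : ∀ φ ψ : C₀(X, ℂ), cintegral (φ + ψ : C₀(X, ℂ)) (ofMeasure μ) =
      cintegral φ (ofMeasure μ) + cintegral ψ (ofMeasure μ) := fun φ ψ =>
    cintegral_add _ (integrable_zeroAtInfty _ _) (integrable_zeroAtInfty _ _)
  have hI : ∀ φ : C₀(X, ℂ), cintegral (Complex.I • φ : C₀(X, ℂ)) (ofMeasure μ) =
      Complex.I * cintegral φ (ofMeasure μ) := fun φ =>
    cintegral_const_mul _ _ (integrable_zeroAtInfty _ _)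
  intro φ
  -- Both sides are continuous in φ and agree on the functions ψ₁ + iψ₂ with ψ₁, ψ₂ compactly
  -- supported, which are dense.
  have hcl : IsClosed {φ : C₀(X, ℂ) | L φ = cintegral φ (ofMeasure μ)} :=
    isClosed_eq L.continuous (continuous_cintegral_zeroAtInfty _)
  refine hcl.closure_subset (Metric.mem_closure_iff.2 fun ε hε => ?_)
  obtain ⟨ψ₁, ψ₂, hψ⟩ := exists_dist_realToZeroAtInfty_lt φ (half_pos hε)
  refine ⟨_, ?_, (dist_eq_norm φ _).trans_lt (hψ.trans_lt (half_lt_self hε))⟩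
  rw [Set.mem_ofPred_eq, hadd, hI, map_add, map_smul, h1, h1, smul_eq_mul]

end regularity

end NSpace

namespace NSpace

open Filter Topology
open scoped CompactlySupported Matrix.Norms.L2Operator

/-! ### The unitary group and its Haar measure -/

section unitaryHaar

/-- The unitaries are closed and lie in the ball of radius ‖1‖ for the operator norm of a
finite-dimensional space. Leaving the radius as ‖1‖ covers n = 0 as well. -/
instance compactSpace_unitaryGroup (n : ℕ) : CompactSpace (Matrix.unitaryGroup (Fin n) ℂ) := by
  have : ProperSpace (Matrix (Fin n) (Fin n) ℂ) := FiniteDimensional.proper ℂ _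
  refine isCompact_iff_compactSpace.1 (Metric.isCompact_of_isClosed_isBounded isClosed_unitary
    ((Metric.isBounded_closedBall (x := (0 : Matrix (Fin n) (Fin n) ℂ))
      (r := ‖(1 : Matrix (Fin n) (Fin n) ℂ)‖)).subset fun U hU => ?_))
  rw [mem_closedBall_zero_iff]
  have h := CStarRing.norm_coe_unitary_mul (⟨U, hU⟩ : unitary (Matrix (Fin n) (Fin n) ℂ)) 1
  rw [mul_one] at h
  exact h.le

noncomputable instance measurableSpace_unitaryGroup (n : ℕ) : MeasurableSpace (Matrix.unitaryGroup (Fin n) ℂ) :=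
  borel _

instance borelSpace_unitaryGroup (n : ℕ) : BorelSpace (Matrix.unitaryGroup (Fin n) ℂ) := ⟨rfl⟩

/-- The Haar probability measure of the unitary group. -/
noncomputable def unitaryHaar (n : ℕ) : Measure (Matrix.unitaryGroup (Fin n) ℂ) :=
  Measure.haarMeasure ⊤

instance isHaarMeasure_unitaryHaar (n : ℕ) : (unitaryHaar n).IsHaarMeasure := by
  unfold unitaryHaar
  infer_instance

instance isProbabilityMeasure_unitaryHaar (n : ℕ) : IsProbabilityMeasure (unitaryHaar n) :=
  ⟨Measure.haarMeasure_self (K₀ := (⊤ : TopologicalSpace.PositiveCompacts _))⟩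

/-- A right translate of Haar measure is again a Haar probability measure, so it coincides with the
original one by uniqueness. -/
instance isMulRightInvariant_unitaryHaar (n : ℕ) : (unitaryHaar n).IsMulRightInvariant where
  map_mul_right_eq_self U := by
    have : IsProbabilityMeasure ((unitaryHaar n).map (· * U)) :=
      Measure.isProbabilityMeasure_map (by fun_prop)
    exact Measure.isHaarMeasure_eq_of_isProbabilityMeasure _ _

end unitaryHaar

/-! ### The action of the unitary group on `C₀(X, Mₙ)` -/

section rotation

variable {n : ℕ}

lemma norm_conj (u : PU n) (A : Matrix (Fin n) (Fin n) ℂ) : ‖conj u A‖ = ‖A‖ := by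
  induction u using QuotientGroup.induction_on with
  | H U =>
    rw [conj_mk, unitaryConj_complex]
    exact (CStarRing.norm_mul_coe_unitary _ (star U)).trans (CStarRing.norm_coe_unitary_mul U A)

lemma conj_one (A : Matrix (Fin n) (Fin n) ℂ) : conj (1 : PU n) A = A := by
  change unitaryConj 1 A = A
  rw [unitaryConj_complex]
  simp

lemma conj_mul_group (u v : PU n) (A : Matrix (Fin n) (Fin n) ℂ) :
    conj (u * v) A = conj u (conj v A) := by
  induction u using QuotientGroup.induction_on with
  | H U =>
    induction v using QuotientGroup.induction_on with
    | H V =>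
      rw [← QuotientGroup.mk_mul, conj_mk, conj_mk, conj_mk, unitaryConj_complex,
        unitaryConj_complex, unitaryConj_complex]
      simp [mul_assoc]

lemma continuous_conj (u : PU n) :
    Continuous fun A : Matrix (Fin n) (Fin n) ℂ => conj u A := by
  induction u using QuotientGroup.induction_on with
  | H U =>
    simp only [conj_mk, unitaryConj_complex]
    fun_prop

variable {X : Type*} [TopologicalSpace X] [MulAction (PU n) X]

/-- The translate `x ↦ u . f (u⁻¹ . x)` of a matrix-valued function. -/
def rotate (u : PU n) (f : X → Matrix (Fin n) (Fin n) ℂ) : X → Matrix (Fin n) (Fin n) ℂ :=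
  fun x => conj u (f (u⁻¹ • x))

variable [ContinuousSMul (PU n) X]

/-- The translate of a function vanishing at infinity. -/
noncomputable def rotateZeroAtInfty (u : PU n) :
    C₀(X, Matrix (Fin n) (Fin n) ℂ) →ₗᵢ[ℂ] C₀(X, Matrix (Fin n) (Fin n) ℂ) where
  toFun f :=
    { toFun := rotate u f
      continuous_toFun := (continuous_conj u).comp
        ((map_continuous f).comp (continuous_const_smul u⁻¹))
      zero_at_infty' := by
        have h1 := (continuous_conj u).tendsto 0
        rw [conj_zero] at h1
        exact h1.comp ((zero_at_infty f).comp
          (Homeomorph.smul u⁻¹).isClosedEmbedding.tendsto_cocompact) }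
  map_add' f g := by
    ext1 x
    exact conj_add u _ _
  map_smul' c f := by
    ext1 x
    exact conj_smul u c _
  norm_map' f := by
    have key : ∀ (u : PU n) (f g : C₀(X, Matrix (Fin n) (Fin n) ℂ)),
        (∀ x, g x = rotate u f x) → ‖g‖ ≤ ‖f‖ := by
      intro u f g h
      rw [← ZeroAtInftyContinuousMap.norm_toBCF_eq_norm (f := g),
        BoundedContinuousFunction.norm_le (norm_nonneg _)]
      intro x
      change ‖g x‖ ≤ _
      rw [h]
      unfold rotate
      rw [norm_conj]
      exact f.toBCF.norm_coe_le_norm _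
    -- The reverse inequality is the same estimate applied to u⁻¹, which undoes the translation.
    refine le_antisymm (key u _ _ fun x => rfl) (key u⁻¹ _ _ fun x => ?_)
    change f x = conj u⁻¹ (conj u (f (u⁻¹ • u⁻¹⁻¹ • x)))
    rw [← conj_mul_group, inv_inv, inv_mul_cancel, conj_one, inv_smul_smul]

lemma rotateZeroAtInfty_apply (u : PU n) (f : C₀(X, Matrix (Fin n) (Fin n) ℂ)) (x : X) :
    rotateZeroAtInfty u f x = conj u (f (u⁻¹ • x)) := rfl

lemma rotateZeroAtInfty_mul_group (u v : PU n) (f : C₀(X, Matrix (Fin n) (Fin n) ℂ)) :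
    rotateZeroAtInfty (u * v) f = rotateZeroAtInfty u (rotateZeroAtInfty v f) := by
  ext1 x
  simp only [rotateZeroAtInfty_apply, conj_mul_group, mul_inv_rev, mul_smul]

/-- Describing C*(X, .) as a fixed-point set makes it visibly closed and reduces membership of an
average to invariance of Haar measure. -/
lemma mem_CStar_iff (f : C₀(X, Matrix (Fin n) (Fin n) ℂ)) :
    f ∈ CStar n X ↔ ∀ u : PU n, rotateZeroAtInfty u f = f := by
  change (∀ (u : PU n) (x : X), f (u • x) = conj u (f x)) ↔ _
  constructor
  · intro h u
    ext1 x
    rw [rotateZeroAtInfty_apply, ← h, smul_inv_smul]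
  · intro h u x
    conv_lhs => rw [← h u]
    rw [rotateZeroAtInfty_apply, inv_smul_smul]

lemma isClosed_CStar : IsClosed (CStar n X : Set C₀(X, Matrix (Fin n) (Fin n) ℂ)) := by
  have : (CStar n X : Set C₀(X, Matrix (Fin n) (Fin n) ℂ)) =
      ⋂ u : PU n, {f | rotateZeroAtInfty u f = f} := by
    ext f
    rw [Set.mem_iInter]
    exact mem_CStar_iff f
  rw [this]
  exact isClosed_iInter fun u =>
    isClosed_eq (rotateZeroAtInfty (X := X) u).continuous continuous_id

/-! ### Averaging over the unitary group. -/

variable [T2Space X] [LocallyCompactSpace X]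

/-- Off the orbit of a compact set all translates of f are uniformly small, and on that compact
orbit joint continuity in (U, x) gives uniform closeness. This continuity in the sup norm makes the
average a Bochner integral in C₀(X, Mₙ). -/
lemma continuous_rotateZeroAtInfty (f : C₀(X, Matrix (Fin n) (Fin n) ℂ)) :
    Continuous fun U : Matrix.unitaryGroup (Fin n) ℂ => rotateZeroAtInfty (U : PU n) f := by
  have hmk : Continuous fun U : Matrix.unitaryGroup (Fin n) ℂ => (U : PU n) :=
    QuotientGroup.continuous_mk
  have hjoint : Continuous fun p : Matrix.unitaryGroup (Fin n) ℂ × X =>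
      rotateZeroAtInfty (p.1 : PU n) f p.2 := by
    have h1 : Continuous fun p : Matrix.unitaryGroup (Fin n) ℂ × X =>
        f ((p.1 : PU n)⁻¹ • p.2) :=
      (map_continuous f).comp ((hmk.comp continuous_fst).inv.smul continuous_snd)
    have h2 : Continuous fun p : Matrix.unitaryGroup (Fin n) ℂ × X =>
        (p.1 : Matrix (Fin n) (Fin n) ℂ) := continuous_subtype_val.comp continuous_fst
    exact (h2.mul h1).mul h2.star
  rw [continuous_iff_continuousAt]
  intro U₀
  refine Metric.tendsto_nhds.2 fun ε hε => ?_
  have hε3 : 0 < ε / 3 := by positivity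
  have h1 : ∀ᶠ x in cocompact X, ‖f x‖ < ε / 3 := by
    have := (zero_at_infty f).norm
    rw [norm_zero] at this
    exact this.eventually_lt_const hε3
  obtain ⟨K, hK, hKε⟩ := mem_cocompact.1 h1
  -- The saturation 𝕌ₙ.K is compact because the group is. If x lies outside it, then u⁻¹.x is never
  -- in K, whatever u is.
  let L : Set X := (fun p : Matrix.unitaryGroup (Fin n) ℂ × X => (p.1 : PU n) • p.2) ''
    (Set.univ ×ˢ K)
  have hL : IsCompact L := (isCompact_univ.prod hK).image
    ((hmk.comp continuous_fst).smul continuous_snd)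
  have hsmall : ∀ (U : Matrix.unitaryGroup (Fin n) ℂ) (x : X), x ∉ L →
      ‖rotateZeroAtInfty (U : PU n) f x‖ < ε / 3 := by
    intro U x hx
    rw [rotateZeroAtInfty_apply, norm_conj]
    refine hKε fun hxK => hx ⟨(U, (U : PU n)⁻¹ • x), ⟨Set.mem_univ _, hxK⟩, ?_⟩
    simp
  have hev : ∀ᶠ U : Matrix.unitaryGroup (Fin n) ℂ in 𝓝 U₀, ∀ x ∈ L,
      dist (rotateZeroAtInfty (U : PU n) f x) (rotateZeroAtInfty (U₀ : PU n) f x) < 2 * (ε / 3) := by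
    refine hL.eventually_forall_of_forall_eventually fun x _ => ?_
    have h2 : Continuous fun p : Matrix.unitaryGroup (Fin n) ℂ × X =>
        dist (rotateZeroAtInfty (p.1 : PU n) f p.2) (rotateZeroAtInfty (U₀ : PU n) f p.2) :=
      hjoint.dist ((map_continuous (rotateZeroAtInfty (U₀ : PU n) f)).comp continuous_snd)
    refine h2.continuousAt.eventually_lt_const ?_
    simpa only [dist_self] using mul_pos two_pos hε3
  filter_upwards [hev] with U hU
  refine lt_of_le_of_lt ?_ (show 2 * (ε / 3) < ε by linarith)
  rw [← ZeroAtInftyContinuousMap.dist_toBCF_eq_dist,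
    BoundedContinuousFunction.dist_le (by positivity)]
  intro x
  change dist (rotateZeroAtInfty (U : PU n) f x) (rotateZeroAtInfty (U₀ : PU n) f x) ≤ _
  by_cases hx : x ∈ L
  · exact (hU x hx).le
  · rw [dist_eq_norm]
    refine (norm_sub_le _ _).trans ?_
    linarith [hsmall U x hx, hsmall U₀ x hx]

lemma integrable_rotateZeroAtInfty (f : C₀(X, Matrix (Fin n) (Fin n) ℂ)) :
    Integrable (fun U : Matrix.unitaryGroup (Fin n) ℂ => rotateZeroAtInfty (U : PU n) f)
      (unitaryHaar n) :=
  (continuous_rotateZeroAtInfty f).integrable_of_hasCompactSupport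
    (HasCompactSupport.of_compactSpace _)

/-- The average of the translates of a function. -/
noncomputable def average :
    C₀(X, Matrix (Fin n) (Fin n) ℂ) →L[ℂ] C₀(X, Matrix (Fin n) (Fin n) ℂ) :=
  LinearMap.mkContinuous
    { toFun := fun f => ∫ U, rotateZeroAtInfty (U : PU n) f ∂(unitaryHaar n)
      map_add' := fun f g => by
        simp only [map_add]
        exact integral_add (integrable_rotateZeroAtInfty f) (integrable_rotateZeroAtInfty g)
      map_smul' := fun c f => by
        simp only [map_smul]
        exact integral_smul c _ } 1 (fun f => by
      refine (norm_integral_le_integral_norm _).trans ?_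
      simp)

lemma average_apply (f : C₀(X, Matrix (Fin n) (Fin n) ℂ)) :
    average f = ∫ U, rotateZeroAtInfty (U : PU n) f ∂(unitaryHaar n) := rfl

/-- Translation by V passes under the integral, where left invariance of Haar measure absorbs it. -/
lemma average_mem_CStar (f : C₀(X, Matrix (Fin n) (Fin n) ℂ)) : average f ∈ CStar n X := by
  rw [mem_CStar_iff]
  intro v
  induction v using QuotientGroup.induction_on with
  | H V =>
    rw [average_apply]
    have h := ContinuousLinearMap.integral_comp_comm
      (rotateZeroAtInfty (X := X) (V : PU n)).toContinuousLinearMap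
      (integrable_rotateZeroAtInfty f)
    refine h.symm.trans ?_
    rw [← integral_mul_left_eq_self
      (fun U : Matrix.unitaryGroup (Fin n) ℂ => rotateZeroAtInfty (U : PU n) f) V]
    congr 1
    ext1 U
    rw [QuotientGroup.mk_mul, rotateZeroAtInfty_mul_group]
    rfl

lemma average_eq_self {f : C₀(X, Matrix (Fin n) (Fin n) ℂ)} (hf : f ∈ CStar n X) :
    average f = f := by
  rw [mem_CStar_iff] at hf
  simp [average_apply, hf]

/-- Here right invariance of Haar measure is used. This identity is the source of the equivariance
of E. -/
lemma average_rotateZeroAtInfty (v : PU n) (f : C₀(X, Matrix (Fin n) (Fin n) ℂ)) :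
    average (rotateZeroAtInfty v f) = average f := by
  induction v using QuotientGroup.induction_on with
  | H V =>
    rw [average_apply, average_apply, ← integral_mul_right_eq_self
      (fun U : Matrix.unitaryGroup (Fin n) ℂ => rotateZeroAtInfty (U : PU n) f) V]
    simp only [QuotientGroup.mk_mul, rotateZeroAtInfty_mul_group]

/-- The matrix-valued function `φ a`. -/
noncomputable def tensor (a : Matrix (Fin n) (Fin n) ℂ) :
    C₀(X, ℂ) →L[ℂ] C₀(X, Matrix (Fin n) (Fin n) ℂ) :=
  LinearMap.mkContinuous
    { toFun := fun φ =>
        { toFun := fun x => φ x • a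
          continuous_toFun := (map_continuous φ).smul continuous_const
          zero_at_infty' := by
            have := (zero_at_infty φ).smul_const a
            rwa [zero_smul] at this }
      map_add' := fun φ ψ => by
        ext1 x
        exact add_smul _ _ _
      map_smul' := fun c φ => by
        ext1 x
        exact mul_smul _ _ _ } ‖a‖ (fun φ => by
      rw [← ZeroAtInftyContinuousMap.norm_toBCF_eq_norm,
        BoundedContinuousFunction.norm_le (by positivity)]
      intro x
      change ‖φ x • a‖ ≤ _
      rw [norm_smul, mul_comm]
      gcongr
      exact φ.toBCF.norm_coe_le_norm x)

lemma tensor_apply (a : Matrix (Fin n) (Fin n) ℂ) (φ : C₀(X, ℂ)) (x : X) :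
    tensor a φ x = φ x • a := rfl

lemma norm_tensor_apply_le (a : Matrix (Fin n) (Fin n) ℂ) (φ : C₀(X, ℂ)) :
    ‖tensor a φ‖ ≤ ‖a‖ * ‖φ‖ :=
  LinearMap.mkContinuous_norm_le _ (norm_nonneg a) _ |> fun h =>
    (ContinuousLinearMap.le_of_opNorm_le _ h φ)

lemma tensor_add (a b : Matrix (Fin n) (Fin n) ℂ) (φ : C₀(X, ℂ)) :
    tensor (a + b) φ = tensor a φ + tensor b φ := by
  ext1 x
  exact smul_add _ _ _

lemma tensor_smul (c : ℂ) (a : Matrix (Fin n) (Fin n) ℂ) (φ : C₀(X, ℂ)) :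
    tensor (c • a) φ = c • tensor a φ := by
  ext1 x
  exact smul_comm _ _ _

/-- The average of `star b * b` has the form `star c * c` with `c` equivariant. -/
lemma exists_average_star_mul_self (b : C₀(X, Matrix (Fin n) (Fin n) ℂ)) :
    ∃ c ∈ CStar n X, average (star b * b) = star c * c := by
  let _ : PartialOrder C₀(X, Matrix (Fin n) (Fin n) ℂ) := CStarAlgebra.spectralOrder _
  have _ : StarOrderedRing C₀(X, Matrix (Fin n) (Fin n) ℂ) := CStarAlgebra.spectralOrderedRing _
  have h1 : 0 ≤ average (star b * b) := by
    rw [average_apply]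
    -- The nonnegative elements form a closed convex set, and each translate of b*b is again a
    -- square.
    refine Convex.integral_mem (s := {f : C₀(X, Matrix (Fin n) (Fin n) ℂ) | 0 ≤ f}) ?_ CStarAlgebra.isClosed_nonneg
      (ae_of_all _ fun U => ?_) (integrable_rotateZeroAtInfty _)
    · exact convex_Ici 0
    · have h2 : rotateZeroAtInfty (U : PU n) (star b * b) =
          star (rotateZeroAtInfty (U : PU n) b) * rotateZeroAtInfty (U : PU n) b := by
        ext1 x
        rw [ZeroAtInftyContinuousMap.mul_apply, ZeroAtInftyContinuousMap.star_apply,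
          rotateZeroAtInfty_apply, rotateZeroAtInfty_apply, ZeroAtInftyContinuousMap.mul_apply,
          ZeroAtInftyContinuousMap.star_apply, conj_mul, conj_star]
      rw [Set.mem_ofPred_eq, h2]
      exact star_mul_self_nonneg _
  have hcl : IsClosed (CStar n X : Set C₀(X, Matrix (Fin n) (Fin n) ℂ)) := isClosed_CStar
  refine ⟨CFC.sqrt (average (star b * b)), ?_, ?_⟩
  -- The square root is given by continuous functional calculus, which does not leave the closed
  -- *-subalgebra C*(X, .).
  · rw [CFC.sqrt_eq_real_sqrt _ h1]
    exact cfcₙ_mem (𝕜' := ℂ) _ (average_mem_CStar _)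
  · have h3 := (IsSelfAdjoint.of_nonneg (CFC.sqrt_nonneg (average (star b * b)))).star_eq
    exact ((congrArg (· * CFC.sqrt (average (star b * b))) h3).trans
      (CFC.sqrt_mul_sqrt_self _ h1)).symm

end rotation

end NSpace

namespace NSpace

open Filter Topology
open scoped CompactlySupported Matrix.Norms.L2Operator

/-! ### Bounded Borel matrix-valued functions -/

section boundedBorel

variable {n : ℕ} {X : Type*} [MeasurableSpace X]

lemma IsBoundedBorel.bounded_entry {f : X → Matrix (Fin n) (Fin n) ℂ} (hf : IsBoundedBorel f)
    (j k : Fin n) : ∃ C : ℝ, ∀ x, ‖f x j k‖ ≤ C :=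
  hf.bounded.imp fun _ hC x => hC x j k

lemma IsBoundedBorel.integrable_entry {f : X → Matrix (Fin n) (Fin n) ℂ} (hf : IsBoundedBorel f)
    (μ : Measure X) [IsFiniteMeasure μ] (j k : Fin n) : Integrable (fun x => f x j k) μ :=
  integrable_of_bounded_measurable μ (hf.measurable j k) (hf.bounded_entry j k)

lemma IsBoundedBorel.mul {f g : X → Matrix (Fin n) (Fin n) ℂ} (hf : IsBoundedBorel f)
    (hg : IsBoundedBorel g) : IsBoundedBorel (f * g) := by
  obtain ⟨C, hC⟩ := hf.bounded
  obtain ⟨D, hD⟩ := hg.bounded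
  refine ⟨fun j k => ?_, ∑ _i : Fin n, C * D, fun x j k => ?_⟩
  · simp only [Pi.mul_apply, Matrix.mul_apply]
    exact Finset.measurable_fun_sum _ fun i _ => (hf.measurable j i).mul (hg.measurable i k)
  · simp only [Pi.mul_apply, Matrix.mul_apply]
    refine norm_sum_le_of_le _ fun i _ => ?_
    rw [norm_mul]
    exact mul_le_mul (hC x j i) (hD x i k) (norm_nonneg _) ((norm_nonneg _).trans (hC x j i))

lemma IsBoundedBorel.star {f : X → Matrix (Fin n) (Fin n) ℂ} (hf : IsBoundedBorel f) :
    IsBoundedBorel (star f) := by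
  obtain ⟨C, hC⟩ := hf.bounded
  exact ⟨fun j k => continuous_star.measurable.comp (hf.measurable k j), C, fun x j k => by
    simpa [Matrix.star_apply] using hC x k j⟩

lemma norm_entry_le_l2_opNorm (A : Matrix (Fin n) (Fin n) ℂ) (j k : Fin n) : ‖A j k‖ ≤ ‖A‖ := by
  have h1 := Matrix.l2_opNorm_mulVec A (EuclideanSpace.single k 1)
  have h2 := PiLp.norm_apply_le
    ((EuclideanSpace.equiv (Fin n) ℂ).symm (A.mulVec (EuclideanSpace.single k 1))) j
  simpa using h2.trans h1

lemma isBoundedBorel_const (A : Matrix (Fin n) (Fin n) ℂ) :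
    IsBoundedBorel (fun _ : X => A) := by
  refine ⟨fun j k => measurable_const, ‖A‖, fun x j k => ?_⟩
  exact norm_entry_le_l2_opNorm A j k

variable [TopologicalSpace X] [BorelSpace X] [MulAction (PU n) X] [ContinuousSMul (PU n) X]

lemma IsBoundedBorel.rotate {f : X → Matrix (Fin n) (Fin n) ℂ} (hf : IsBoundedBorel f)
    (u : PU n) : IsBoundedBorel (rotate u f) := by
  have h1 : IsBoundedBorel fun x => f (u⁻¹ • x) :=
    ⟨fun j k => (hf.measurable j k).comp (continuous_const_smul u⁻¹).measurable,
      hf.bounded.imp fun C hC x => hC _⟩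
  induction u using QuotientGroup.induction_on with
  | H U =>
    exact ((isBoundedBorel_const (U : Matrix (Fin n) (Fin n) ℂ)).mul h1).mul
      (isBoundedBorel_const (Star.star (U : Matrix (Fin n) (Fin n) ℂ)))

lemma rotate_mul (u : PU n) (f g : X → Matrix (Fin n) (Fin n) ℂ) :
    NSpace.rotate u (f * g) = NSpace.rotate u f * NSpace.rotate u g := by
  ext1 x
  exact conj_mul u _ _

lemma rotate_star (u : PU n) (f : X → Matrix (Fin n) (Fin n) ℂ) :
    NSpace.rotate u (star f) = star (NSpace.rotate u f) := by
  ext1 x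
  exact conj_star u _

lemma rotate_eq_self {f : X → Matrix (Fin n) (Fin n) ℂ} (hf : f ∈ BCStar n X) (u : PU n) :
    NSpace.rotate u f = f := by
  ext1 x
  change conj u (f (u⁻¹ • x)) = f x
  rw [← hf.2, smul_inv_smul]

end boundedBorel

/-! ### Matrices of complex measures -/

section pairing

variable {n : ℕ} {X : Type*} [MeasurableSpace X]

/-- The integral `∑_{j,k} ∫ f_{jk} dν_{kj}` of a matrix-valued function against a matrix of complex
measures. -/
noncomputable def pairing (ν : Fin n → Fin n → ComplexMeasure X)
    (f : X → Matrix (Fin n) (Fin n) ℂ) : ℂ :=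
  ∑ j, ∑ k, cintegral (fun x => f x j k) (ν k j)

/-- The matrix of complex measures `g ν`. -/
noncomputable def leftDensity (g : X → Matrix (Fin n) (Fin n) ℂ)
    (ν : Fin n → Fin n → ComplexMeasure X) : Fin n → Fin n → ComplexMeasure X :=
  fun i j => ∑ k, densityMeasure (fun x => g x i k) (ν k j)

/-- The matrix of complex measures `ν g`. -/
noncomputable def rightDensity (g : X → Matrix (Fin n) (Fin n) ℂ)
    (ν : Fin n → Fin n → ComplexMeasure X) : Fin n → Fin n → ComplexMeasure X :=
  fun k i => ∑ j, densityMeasure (fun x => g x j i) (ν k j)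

/-- The adjoint of a matrix of complex measures. -/
noncomputable def adjointFamily (ν : Fin n → Fin n → ComplexMeasure X) :
    Fin n → Fin n → ComplexMeasure X :=
  fun j k => conjMeasure (ν k j)

lemma cintegral_entry_mul (ν : ComplexMeasure X) {f g : X → Matrix (Fin n) (Fin n) ℂ}
    (hf : IsBoundedBorel f) (hg : IsBoundedBorel g) (j k : Fin n) :
    cintegral (fun x => (f * g) x j k) ν = ∑ i, cintegral (fun x => f x j i * g x i k) ν := by
  simp only [Pi.mul_apply, Matrix.mul_apply]
  exact cintegral_finsetSum _ _ fun i _ => integrable_mul_of_bounded _ (hf.integrable_entry _ j i)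
    (hg.measurable i k) (hg.bounded_entry i k)

/-- The pairing is formally ∫ tr(f dν), and this is tr(f (g dν)) = tr((f g) dν). -/
lemma pairing_leftDensity (ν : Fin n → Fin n → ComplexMeasure X)
    {f g : X → Matrix (Fin n) (Fin n) ℂ} (hf : IsBoundedBorel f) (hg : IsBoundedBorel g) :
    pairing (leftDensity g ν) f = pairing ν (f * g) := by
  unfold pairing leftDensity
  refine Finset.sum_congr rfl fun j _ => ?_
  simp_rw [cintegral_entry_mul _ hf hg]
  rw [Finset.sum_comm]
  refine Finset.sum_congr rfl fun i _ => ?_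
  rw [cintegral_finsetSum_measure _ _ (hf.measurable j i) (hf.bounded_entry j i)]
  refine Finset.sum_congr rfl fun k _ => ?_
  exact cintegral_densityMeasure _ (hg.measurable i k) (hg.bounded_entry i k) (hf.measurable j i)
    (hf.bounded_entry j i)

/-- Cyclicity of the trace: tr(g (dν f)) = tr((f g) dν). -/
lemma pairing_rightDensity (ν : Fin n → Fin n → ComplexMeasure X)
    {f g : X → Matrix (Fin n) (Fin n) ℂ} (hf : IsBoundedBorel f) (hg : IsBoundedBorel g) :
    pairing (rightDensity f ν) g = pairing ν (f * g) := by
  unfold pairing rightDensity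
  simp_rw [cintegral_entry_mul _ hf hg]
  have h1 : ∀ j k, cintegral (fun x => g x j k) (∑ i, densityMeasure (fun x => f x i j) (ν k i)) =
      ∑ i, cintegral (fun x => f x i j * g x j k) (ν k i) := by
    intro j k
    rw [cintegral_finsetSum_measure _ _ (hg.measurable j k) (hg.bounded_entry j k)]
    refine Finset.sum_congr rfl fun i _ => ?_
    rw [cintegral_densityMeasure _ (hf.measurable i j) (hf.bounded_entry i j) (hg.measurable j k)
      (hg.bounded_entry j k)]
    simp_rw [mul_comm]
  simp_rw [h1]
  calc ∑ j, ∑ k, ∑ i, cintegral (fun x => f x i j * g x j k) (ν k i)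
      = ∑ j, ∑ i, ∑ k, cintegral (fun x => f x i j * g x j k) (ν k i) :=
        Finset.sum_congr rfl fun j _ => Finset.sum_comm
    _ = ∑ i, ∑ j, ∑ k, cintegral (fun x => f x i j * g x j k) (ν k i) := Finset.sum_comm
    _ = _ := Finset.sum_congr rfl fun j _ => Finset.sum_comm

lemma pairing_adjointFamily (ν : Fin n → Fin n → ComplexMeasure X)
    {f : X → Matrix (Fin n) (Fin n) ℂ} (hf : IsBoundedBorel f) :
    pairing (adjointFamily ν) f = starRingEnd ℂ (pairing ν (star f)) := by
  unfold pairing adjointFamily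
  simp_rw [map_sum]
  rw [Finset.sum_comm]
  refine Finset.sum_congr rfl fun j _ => Finset.sum_congr rfl fun k _ => ?_
  rw [cintegral_conjMeasure _ (hf.measurable k j) (hf.bounded_entry k j)]
  rfl

variable [TopologicalSpace X] [T2Space X] [BorelSpace X]

lemma isRegular_leftDensity {ν : Fin n → Fin n → ComplexMeasure X} (hν : ∀ j k, IsRegular (ν j k))
    {g : X → Matrix (Fin n) (Fin n) ℂ} (hg : IsBoundedBorel g) (j k : Fin n) :
    IsRegular (leftDensity g ν j k) :=
  IsRegular.finsetSum _ fun i _ =>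
    (hν i k).densityMeasure (hg.measurable j i) (hg.bounded_entry j i)

lemma isRegular_rightDensity {ν : Fin n → Fin n → ComplexMeasure X}
    (hν : ∀ j k, IsRegular (ν j k)) {g : X → Matrix (Fin n) (Fin n) ℂ} (hg : IsBoundedBorel g)
    (j k : Fin n) : IsRegular (rightDensity g ν j k) :=
  IsRegular.finsetSum _ fun i _ =>
    (hν j i).densityMeasure (hg.measurable i k) (hg.bounded_entry i k)

/-! ### Invariance of matrices of measures under the unitary group. -/

variable [MulAction (PU n) X] [ContinuousSMul (PU n) X]

/-- The matrix of complex measures `A ↦ U⁻¹ ν(U . A) U`. -/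
noncomputable def rotateFamily (U : Matrix.unitaryGroup (Fin n) ℂ)
    (ν : Fin n → Fin n → ComplexMeasure X) : Fin n → Fin n → ComplexMeasure X :=
  fun j k => ∑ a, ∑ b, (star (U : Matrix (Fin n) (Fin n) ℂ) j a *
    (U : Matrix (Fin n) (Fin n) ℂ) b k) •
      (ν a b).map (Homeomorph.smul (U : PU n)⁻¹ : X ≃ₜ X)

lemma rotateFamily_apply (U : Matrix.unitaryGroup (Fin n) ℂ)
    (ν : Fin n → Fin n → ComplexMeasure X) (j k : Fin n) {A : Set X} (hA : MeasurableSet A) :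
    rotateFamily U ν j k A = (star (U : Matrix (Fin n) (Fin n) ℂ) *
      Matrix.of (fun a b => ν a b ((U : PU n) • A)) * (U : Matrix (Fin n) (Fin n) ℂ)) j k := by
  have h1 : ∀ a b, (ν a b).map (Homeomorph.smul (U : PU n)⁻¹ : X ≃ₜ X) A =
      ν a b ((U : PU n) • A) := by
    intro a b
    rw [VectorMeasure.map_apply _ (Homeomorph.measurable _) hA]
    congr 1
    exact (Set.preimage_smul_inv (U : PU n) A)
  simp only [rotateFamily, _root_.sum_apply, _root_.smul_apply, h1,
    Matrix.mul_apply, Matrix.of_apply, Finset.sum_mul, smul_eq_mul]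
  rw [Finset.sum_comm]
  exact Finset.sum_congr rfl fun b _ => Finset.sum_congr rfl fun a _ => by ring

lemma isRegular_rotateFamily (U : Matrix.unitaryGroup (Fin n) ℂ)
    {ν : Fin n → Fin n → ComplexMeasure X} (hν : ∀ j k, IsRegular (ν j k)) (j k : Fin n) :
    IsRegular (rotateFamily U ν j k) :=
  IsRegular.finsetSum _ fun a _ => IsRegular.finsetSum _ fun b _ => ((hν a b).map _).smul _

/-- The change of variables x = u⁻¹.y combined with tr(f U*νU) = tr(U f U*ν). After expanding both
sides into fourfold sums only the order of summation differs. -/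
lemma pairing_rotateFamily (U : Matrix.unitaryGroup (Fin n) ℂ)
    (ν : Fin n → Fin n → ComplexMeasure X) {f : X → Matrix (Fin n) (Fin n) ℂ}
    (hf : IsBoundedBorel f) :
    pairing (rotateFamily U ν) f = pairing ν (rotate (U : PU n) f) := by
  have hf' : IsBoundedBorel fun x => f ((U : PU n)⁻¹ • x) :=
    ⟨fun j k => (hf.measurable j k).comp (continuous_const_smul _).measurable,
      hf.bounded.imp fun C hC x => hC _⟩
  have h1 : ∀ j k, cintegral (fun x => f x j k) (rotateFamily U ν k j) =
      ∑ a, ∑ b, (star (U : Matrix (Fin n) (Fin n) ℂ) k a * (U : Matrix (Fin n) (Fin n) ℂ) b j) *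
        cintegral (fun x => f ((U : PU n)⁻¹ • x) j k) (ν a b) := by
    intro j k
    unfold rotateFamily
    rw [cintegral_finsetSum_measure _ _ (hf.measurable j k) (hf.bounded_entry j k)]
    refine Finset.sum_congr rfl fun a _ => ?_
    rw [cintegral_finsetSum_measure _ _ (hf.measurable j k) (hf.bounded_entry j k)]
    refine Finset.sum_congr rfl fun b _ => ?_
    rw [cintegral_smul_measure]
    congr 1
    exact (Homeomorph.measurableEmbedding _).integral_map_vectorMeasure
  have h2 : ∀ j k, cintegral (fun x => rotate (U : PU n) f x j k) (ν k j) =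
      ∑ b, ∑ a, (star (U : Matrix (Fin n) (Fin n) ℂ) b k * (U : Matrix (Fin n) (Fin n) ℂ) j a) *
        cintegral (fun x => f ((U : PU n)⁻¹ • x) a b) (ν k j) := by
    intro j k
    have h3 : (fun x => rotate (U : PU n) f x j k) = fun x => ∑ b, ∑ a,
        (star (U : Matrix (Fin n) (Fin n) ℂ) b k * (U : Matrix (Fin n) (Fin n) ℂ) j a) *
          f ((U : PU n)⁻¹ • x) a b := by
      ext x
      change unitaryConj U (f ((U : PU n)⁻¹ • x)) j k = _
      rw [unitaryConj_complex]
      simp only [Matrix.mul_apply, Finset.sum_mul]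
      exact Finset.sum_congr rfl fun b _ => Finset.sum_congr rfl fun a _ => by ring
    rw [h3, cintegral_finsetSum _ _ fun b _ => integrable_finsetSum _ fun a _ =>
      (hf'.integrable_entry _ a b).const_mul _]
    refine Finset.sum_congr rfl fun b _ => ?_
    rw [cintegral_finsetSum _ _ fun a _ => (hf'.integrable_entry _ a b).const_mul _]
    exact Finset.sum_congr rfl fun a _ => cintegral_const_mul _ _ (hf'.integrable_entry _ a b)
  unfold pairing
  simp_rw [h1, h2]
  calc _ = ∑ j, ∑ a, ∑ k, ∑ b, (star (U : Matrix (Fin n) (Fin n) ℂ) k a *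
        (U : Matrix (Fin n) (Fin n) ℂ) b j) *
          cintegral (fun x => f ((U : PU n)⁻¹ • x) j k) (ν a b) :=
        Finset.sum_congr rfl fun j _ => Finset.sum_comm
    _ = ∑ a, ∑ j, ∑ b, ∑ k, (star (U : Matrix (Fin n) (Fin n) ℂ) k a *
        (U : Matrix (Fin n) (Fin n) ℂ) b j) *
          cintegral (fun x => f ((U : PU n)⁻¹ • x) j k) (ν a b) := by
        rw [Finset.sum_comm]
        exact Finset.sum_congr rfl fun a _ => Finset.sum_congr rfl fun j _ => Finset.sum_comm
    _ = ∑ a, ∑ b, ∑ k, ∑ j, (star (U : Matrix (Fin n) (Fin n) ℂ) k a *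
        (U : Matrix (Fin n) (Fin n) ℂ) b j) *
          cintegral (fun x => f ((U : PU n)⁻¹ • x) j k) (ν a b) := by
        refine Finset.sum_congr rfl fun a _ => ?_
        rw [Finset.sum_comm]
        exact Finset.sum_congr rfl fun b _ => Finset.sum_comm
    _ = _ := Finset.sum_comm

/-- A matrix of complex measures is invariant when the integral against it is. -/
def IsInvariant (ν : Fin n → Fin n → ComplexMeasure X) : Prop :=
  ∀ (U : Matrix.unitaryGroup (Fin n) ℂ) (f : X → Matrix (Fin n) (Fin n) ℂ), IsBoundedBorel f →
    pairing ν (rotate (U : PU n) f) = pairing ν f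

lemma isInvariant_of_rotateFamily_eq {ν : Fin n → Fin n → ComplexMeasure X}
    (h : ∀ U, rotateFamily U ν = ν) : IsInvariant ν := fun U f hf => by
  rw [← pairing_rotateFamily U ν hf, h]

lemma IsInvariant.adjointFamily {ν : Fin n → Fin n → ComplexMeasure X} (hν : IsInvariant ν) :
    IsInvariant (adjointFamily ν) := fun U f hf => by
  rw [pairing_adjointFamily ν (hf.rotate _), pairing_adjointFamily ν hf, ← rotate_star,
    hν U _ hf.star]

/-- Translation of functions is multiplicative and fixes g, so (u·f)g = u·(f g). -/
lemma IsInvariant.leftDensity {ν : Fin n → Fin n → ComplexMeasure X} (hν : IsInvariant ν)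
    {g : X → Matrix (Fin n) (Fin n) ℂ} (hg : g ∈ BCStar n X) :
    IsInvariant (leftDensity g ν) := fun U f hf => by
  rw [pairing_leftDensity ν (hf.rotate _) hg.1, pairing_leftDensity ν hf hg.1,
    ← hν U _ (hf.mul hg.1), rotate_mul, rotate_eq_self hg]

lemma IsInvariant.rightDensity {ν : Fin n → Fin n → ComplexMeasure X} (hν : IsInvariant ν)
    {g : X → Matrix (Fin n) (Fin n) ℂ} (hg : g ∈ BCStar n X) :
    IsInvariant (rightDensity g ν) := fun U f hf => by
  rw [pairing_rightDensity ν hg.1 (hf.rotate _), pairing_rightDensity ν hg.1 hf,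
    ← hν U _ (hg.1.mul hf), rotate_mul, rotate_eq_self hg]

/-! ### Pairing with C₀(X, Mₙ) and uniqueness of invariant families. -/

variable [LocallyCompactSpace X]

/-- The `(j, k)` entry of a function vanishing at infinity. -/
noncomputable def entryCLM (j k : Fin n) : C₀(X, Matrix (Fin n) (Fin n) ℂ) →L[ℂ] C₀(X, ℂ) :=
  LinearMap.mkContinuous
    { toFun := fun f =>
        { toFun := fun x => f x j k
          continuous_toFun := (map_continuous f).matrix_elem j k
          zero_at_infty' := by
            have h1 : Continuous fun A : Matrix (Fin n) (Fin n) ℂ => A j k :=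
              continuous_id.matrix_elem j k
            exact (h1.tendsto 0).comp (zero_at_infty f) }
      map_add' := fun _ _ => rfl
      map_smul' := fun _ _ => rfl } 1 (fun f => by
      rw [one_mul, ← ZeroAtInftyContinuousMap.norm_toBCF_eq_norm,
        BoundedContinuousFunction.norm_le (norm_nonneg _)]
      intro x
      exact (norm_entry_le_l2_opNorm (f x) j k).trans (f.toBCF.norm_coe_le_norm x))

/-- Integration against a complex measure, as a functional on `C₀(X, ℂ)`. -/
noncomputable def cintegralCLM (ν : ComplexMeasure X) : C₀(X, ℂ) →L[ℂ] ℂ where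
  toFun φ := cintegral φ ν
  map_add' φ ψ := cintegral_add ν (integrable_zeroAtInfty _ φ) (integrable_zeroAtInfty _ ψ)
  map_smul' c φ := cintegral_const_mul c ν (integrable_zeroAtInfty _ φ)
  cont := continuous_cintegral_zeroAtInfty ν

/-- Integration against a matrix of complex measures, as a functional on `C₀(X, Mₙ)`. -/
noncomputable def pairingCLM (ν : Fin n → Fin n → ComplexMeasure X) :
    C₀(X, Matrix (Fin n) (Fin n) ℂ) →L[ℂ] ℂ :=
  ∑ j, ∑ k, cintegralCLM (ν k j) ∘L entryCLM j k

lemma pairingCLM_apply (ν : Fin n → Fin n → ComplexMeasure X)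
    (f : C₀(X, Matrix (Fin n) (Fin n) ℂ)) : pairingCLM ν f = pairing ν f := by
  simp only [pairingCLM, _root_.sum_apply]
  rfl

/-- The pairing is a continuous functional, so it commutes with the Bochner integral; the integrand
is then constant and Haar measure has mass 1. -/
lemma IsInvariant.pairing_average {ν : Fin n → Fin n → ComplexMeasure X} (hν : IsInvariant ν)
    (f : C₀(X, Matrix (Fin n) (Fin n) ℂ)) : pairing ν (average f) = pairing ν f := by
  rw [← pairingCLM_apply, ← pairingCLM_apply, average_apply,
    ← ContinuousLinearMap.integral_comp_comm _ (integrable_rotateZeroAtInfty f)]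
  have h1 : ∀ U : Matrix.unitaryGroup (Fin n) ℂ,
      pairingCLM ν (rotateZeroAtInfty (U : PU n) f) = pairingCLM ν f := by
    intro U
    rw [pairingCLM_apply, pairingCLM_apply]
    exact hν U f (isBoundedBorel_zeroAtInfty f)
  simp [h1]

/-- Matrix units isolate a single measure, so the pairing controls every entry. The indices are
transposed because f_{jk} is integrated against ν_{kj}. -/
lemma pairing_tensor_single (ν : Fin n → Fin n → ComplexMeasure X) (j k : Fin n) (φ : C₀(X, ℂ)) :
    pairing ν (tensor (Matrix.single k j 1) φ) = cintegral φ (ν j k) := by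
  have h0 : ∀ μ : ComplexMeasure X, cintegral (fun _ => 0) μ = 0 := fun μ =>
    VectorMeasure.integral_zero
  unfold pairing
  rw [Finset.sum_eq_single k, Finset.sum_eq_single j]
  · congr 1
    ext x
    simp [tensor_apply]
  · intro b _ hb
    simp [tensor_apply, hb.symm, h0]
  · simp
  · intro b _ hb
    refine Finset.sum_eq_zero fun c _ => ?_
    simp [tensor_apply, hb.symm, h0]
  · simp

lemma eq_of_pairing_eq {μ ν : Fin n → Fin n → ComplexMeasure X} (hμ : ∀ j k, IsRegular (μ j k))
    (hν : ∀ j k, IsRegular (ν j k))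
    (h : ∀ f : C₀(X, Matrix (Fin n) (Fin n) ℂ), pairing μ f = pairing ν f) : μ = ν := by
  ext1 j
  ext1 k
  refine (hμ j k).eq_of_cintegral_eq (hν j k) fun φ => ?_
  rw [← pairing_tensor_single μ j k, ← pairing_tensor_single ν j k, h]

/-- Invariant regular matrices of complex measures are determined by the integrals of the
elements of `C*(X, .)`. -/
lemma IsInvariant.eq_of_pairing_eq {μ ν : Fin n → Fin n → ComplexMeasure X}
    (hμi : IsInvariant μ) (hνi : IsInvariant ν) (hμ : ∀ j k, IsRegular (μ j k))
    (hν : ∀ j k, IsRegular (ν j k))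
    (h : ∀ f ∈ CStar n X, pairing μ f = pairing ν f) : μ = ν := by
  refine NSpace.eq_of_pairing_eq hμ hν fun f => ?_
  rw [← hμi.pairing_average, ← hνi.pairing_average, h _ (average_mem_CStar f)]

end pairing

end NSpace

namespace NSpace

open Filter Topology
open scoped CompactlySupported Matrix.Norms.L2Operator

/-! ### Operator-valued `n`-measures and their matrices of complex measures -/

section pairingLinear

variable {n : ℕ} {X : Type*} [MeasurableSpace X]

lemma pairing_add (ν : Fin n → Fin n → ComplexMeasure X) {f g : X → Matrix (Fin n) (Fin n) ℂ}
    (hf : IsBoundedBorel f) (hg : IsBoundedBorel g) :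
    pairing ν (f + g) = pairing ν f + pairing ν g := by
  simp only [pairing, ← Finset.sum_add_distrib]
  exact Finset.sum_congr rfl fun j _ => Finset.sum_congr rfl fun k _ =>
    cintegral_add _ (hf.integrable_entry _ j k) (hg.integrable_entry _ j k)

lemma pairing_smul (ν : Fin n → Fin n → ComplexMeasure X) (c : ℂ)
    {f : X → Matrix (Fin n) (Fin n) ℂ} (hf : IsBoundedBorel f) :
    pairing ν (c • f) = c * pairing ν f := by
  simp only [pairing, Finset.mul_sum]
  exact Finset.sum_congr rfl fun j _ => Finset.sum_congr rfl fun k _ =>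
    cintegral_const_mul c _ (hf.integrable_entry _ j k)

lemma pairing_zero (ν : Fin n → Fin n → ComplexMeasure X) :
    pairing ν (0 : X → Matrix (Fin n) (Fin n) ℂ) = 0 := by
  have h0 : ∀ μ : ComplexMeasure X, cintegral (fun _ => 0) μ = 0 := fun μ =>
    VectorMeasure.integral_zero
  simp [pairing, h0]

end pairingLinear

section entries

variable {n : ℕ} {X : Type*} [TopologicalSpace X] [MeasurableSpace X] [BorelSpace X]
  [MulAction (PU n) X] [ContinuousSMul (PU n) X]
  {H : Type*} [NormedAddCommGroup H] [InnerProductSpace ℂ H] [CompleteSpace H]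

/-- Conjugation by a scalar matrix commutes with taking matrix coefficients, so equivariance in
Mₙ(B(H)) can be tested in Mₙ(ℂ). -/
lemma inner_unitaryConj_apply (U : Matrix.unitaryGroup (Fin n) ℂ)
    (T : Matrix (Fin n) (Fin n) (H →L[ℂ] H)) (h w : H) (j k : Fin n) :
    ⟪w, unitaryConj U T j k h⟫_ℂ = ((U : Matrix (Fin n) (Fin n) ℂ) *
      Matrix.of (fun a b => ⟪w, T a b h⟫_ℂ) * star (U : Matrix (Fin n) (Fin n) ℂ)) j k := by
  have h1 : ((U⁻¹ : Matrix.unitaryGroup (Fin n) ℂ) : Matrix (Fin n) (Fin n) ℂ) =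
      star (U : Matrix (Fin n) (Fin n) ℂ) := rfl
  unfold unitaryConj
  rw [h1]
  simp only [Matrix.mul_apply, Matrix.map_apply, Matrix.of_apply, Finset.sum_mul,
    _root_.sum_apply, inner_sum]
  refine Finset.sum_congr rfl fun b _ => Finset.sum_congr rfl fun a _ => ?_
  simp only [Algebra.algebraMap_eq_smul_one, smul_mul_assoc, one_mul, mul_smul_comm, mul_one,
    _root_.smul_apply, inner_smul_right]
  ring

namespace OperatorNMeasure

variable (E : OperatorNMeasure n X H)

/-- The matrix of the complex measures `A ↦ ⟨E_{jk}(A) h, w⟩`. -/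
noncomputable def entries (h w : H) : Fin n → Fin n → ComplexMeasure X :=
  fun j k => E.entry j k h w

lemma inner_integral {f : X → Matrix (Fin n) (Fin n) ℂ} (hf : IsBoundedBorel f) (h w : H) :
    ⟪w, E.integral f hf h⟫_ℂ = pairing (E.entries h w) f := by
  simp only [integral, _root_.sum_apply, inner_sum, inner_entryIntegral]
  rfl

variable [T2Space X]

/-- Equivariance of E reads ν(U.A) = U ν(A) U*, which is the same as U* ν(U.A) U = ν(A). -/
lemma isInvariant_entries (h w : H) : IsInvariant (E.entries h w) := by
  refine isInvariant_of_rotateFamily_eq fun U => ?_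
  ext j k A hA
  rw [rotateFamily_apply U _ j k hA]
  have h1 : Matrix.of (fun a b => E.entries h w a b ((U : PU n) • A)) =
      (U : Matrix (Fin n) (Fin n) ℂ) * Matrix.of (fun a b => E.entries h w a b A) *
        star (U : Matrix (Fin n) (Fin n) ℂ) := by
    have h3 : (fun a b => E.entries h w a b A) =
        fun a b => ⟪w, E.toFun ⟨A, hA⟩ a b h⟫_ℂ := by
      ext a b
      exact E.entry_apply a b h w hA
    rw [h3]
    ext a b
    rw [← inner_unitaryConj_apply, ← conj_mk, ← E.equivariant]
    exact E.entry_apply a b h w (hA.const_smul (U : PU n))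
  have h2 : star (U : Matrix (Fin n) (Fin n) ℂ) * (U : Matrix (Fin n) (Fin n) ℂ) = 1 :=
    Unitary.coe_star_mul_self U
  rw [h1, ← mul_assoc, ← mul_assoc, h2, one_mul, mul_assoc, h2, mul_one, Matrix.of_apply]

variable {E} in
lemma Regular.entries (hE : E.Regular) (h w : H) (j k : Fin n) :
    IsRegular (E.entries h w j k) := hE j k h w

lemma ext_of_entries {E F : OperatorNMeasure n X H} (h : ∀ x w, E.entries x w = F.entries x w) :
    E = F := by
  ext A j k x
  refine ext_inner_left ℂ fun w => ?_
  rw [← E.entry_apply j k x w A.2, ← F.entry_apply j k x w A.2]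
  exact congrArg (fun ν : ComplexMeasure X => ν A) (congrFun (congrFun (h x w) j) k)

variable [LocallyCompactSpace X]

/-- A regular operator-valued `n`-measure is determined by the integrals of the elements of
`C*(X, .)`. -/
lemma eq_of_integral_eq {E F : OperatorNMeasure n X H} (hE : E.Regular) (hF : F.Regular)
    (h : ∀ f : CStar n X, E.integral (CStar.toBCStar f) (CStar.toBCStar f).2.1 =
      F.integral (CStar.toBCStar f) (CStar.toBCStar f).2.1) : E = F := by
  refine ext_of_entries fun x w => (E.isInvariant_entries x w).eq_of_pairing_eq
    (F.isInvariant_entries x w) (hE.entries x w) (hF.entries x w) fun f hf => ?_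
  have h1 := congrArg (fun T : H →L[ℂ] H => ⟪w, T x⟫_ℂ) (h ⟨f, hf⟩)
  simp only [inner_integral] at h1
  exact h1

/-! ### The spectral property of a regular n-measure that represents π. -/

variable {E} {π : CStar n X →⋆ₙₐ[ℂ] (H →L[ℂ] H)} (hE : E.Regular)
  (hπ : ∀ f : CStar n X, π f = E.integral (CStar.toBCStar f) (CStar.toBCStar f).2.1)

include hE hπ

lemma pairing_entries_CStar (f : CStar n X) (h w : H) :
    pairing (E.entries h w) (f : C₀(X, Matrix (Fin n) (Fin n) ℂ)) = ⟪w, π f h⟫_ℂ := by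
  rw [hπ, inner_integral]
  rfl

/-- Both families are invariant and regular, and on C*(X, .) their pairings agree because π(f*) =
π(f)*. -/
lemma adjointFamily_entries (h w : H) : adjointFamily (E.entries w h) = E.entries h w := by
  refine (E.isInvariant_entries w h).adjointFamily.eq_of_pairing_eq (E.isInvariant_entries h w)
    (fun j k => (hE.entries w h k j).conjMeasure) (hE.entries h w) fun f hf => ?_
  rw [pairing_adjointFamily _ (isBoundedBorel_zeroAtInfty f)]
  have h1 := pairing_entries_CStar hE hπ ⟨f, hf⟩ h w
  have h2 := pairing_entries_CStar hE hπ (star ⟨f, hf⟩) w h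
  rw [map_star, ContinuousLinearMap.star_eq_adjoint, ContinuousLinearMap.adjoint_inner_right] at h2
  rw [h1, ← inner_conj_symm, ← h2]
  rfl

lemma adjoint_integral_of_representation {f : X → Matrix (Fin n) (Fin n) ℂ}
    (hf : IsBoundedBorel f) :
    ContinuousLinearMap.adjoint (E.integral f hf) = E.integral (star f) hf.star := by
  ext h
  refine ext_inner_left ℂ fun w => ?_
  rw [ContinuousLinearMap.adjoint_inner_right, inner_integral, ← adjointFamily_entries hE hπ h w,
    pairing_adjointFamily _ hf.star, star_star, ← inner_integral _ hf, inner_conj_symm]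

/-- Paired with f in C*(X, .), the two sides are the coefficients of π(f g) and of π(f)π(g).
Equality of the measures then allows f to be Borel. -/
lemma leftDensity_entries (g : CStar n X) (h w : H) :
    leftDensity (g : C₀(X, Matrix (Fin n) (Fin n) ℂ)) (E.entries h w) = E.entries (π g h) w := by
  have hg := isBoundedBorel_zeroAtInfty (g : C₀(X, Matrix (Fin n) (Fin n) ℂ))
  have hi : IsInvariant (leftDensity (g : C₀(X, Matrix (Fin n) (Fin n) ℂ)) (E.entries h w)) :=
    (E.isInvariant_entries h w).leftDensity (CStar.toBCStar g).2
  refine hi.eq_of_pairing_eq (E.isInvariant_entries _ w)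
    (isRegular_leftDensity (hE.entries h w) hg) (hE.entries _ w) fun f hf => ?_
  rw [pairing_leftDensity _ (isBoundedBorel_zeroAtInfty f) hg]
  have h1 := pairing_entries_CStar hE hπ (⟨f, hf⟩ * g) h w
  have h2 := pairing_entries_CStar hE hπ ⟨f, hf⟩ (π g h) w
  rw [h2]
  rw [map_mul] at h1
  exact h1

lemma pairing_entries_mul_CStar {f : X → Matrix (Fin n) (Fin n) ℂ} (hf : IsBoundedBorel f)
    (g : CStar n X) (h w : H) :
    pairing (E.entries h w) (f * (g : C₀(X, Matrix (Fin n) (Fin n) ℂ))) =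
      ⟪w, E.integral f hf (π g h)⟫_ℂ := by
  rw [← pairing_leftDensity _ hf (isBoundedBorel_zeroAtInfty _), E.inner_integral,
    leftDensity_entries hE hπ]

/-- The product rule with a continuous right factor g says that both sides pair equally with C*(X,
.). Invariance of the left side is where equivariance of the Borel function f enters. -/
lemma rightDensity_entries (f : BCStar n X) (h w : H) :
    rightDensity f (E.entries h w) =
      E.entries h (ContinuousLinearMap.adjoint (E.integral f f.2.1) w) := by
  refine ((E.isInvariant_entries h w).rightDensity f.2).eq_of_pairing_eq
    (E.isInvariant_entries h _) (isRegular_rightDensity (hE.entries h w) f.2.1)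
    (hE.entries h _) fun g hg => ?_
  rw [pairing_rightDensity _ f.2.1 (isBoundedBorel_zeroAtInfty g)]
  refine (pairing_entries_mul_CStar hE hπ f.2.1 ⟨g, hg⟩ h w).trans ?_
  rw [← ContinuousLinearMap.adjoint_inner_left]
  exact (pairing_entries_CStar hE hπ ⟨g, hg⟩ _ _).symm

lemma integral_mul_of_representation (f g : BCStar n X) :
    E.integral (f * g : BCStar n X) (f * g).2.1 = E.integral f f.2.1 * E.integral g g.2.1 := by
  ext h
  refine ext_inner_left ℂ fun w => ?_
  have h1 : ⟪w, E.integral (f * g : BCStar n X) (f * g).2.1 h⟫_ℂ =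
      pairing (E.entries h w) (f * g) := E.inner_integral _ h w
  have h2 : ⟪w, (E.integral f f.2.1 * E.integral g g.2.1) h⟫_ℂ =
      ⟪w, E.integral f f.2.1 (E.integral g g.2.1 h)⟫_ℂ := rfl
  rw [h1, h2, ← ContinuousLinearMap.adjoint_inner_left, E.inner_integral g.2.1,
    ← rightDensity_entries hE hπ, pairing_rightDensity _ f.2.1 g.2.1]

end OperatorNMeasure

/-- Integration against a spectral `n`-measure is a representation of `ℬC*(X, .)`. -/
noncomputable def SpectralNMeasure.representation (E : SpectralNMeasure n X H) :
    BCStar n X →⋆ₙₐ[ℂ] (H →L[ℂ] H) where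
  toFun f := E.integral f f.2.1
  map_smul' c f := by
    ext h
    refine ext_inner_left ℂ fun w => ?_
    rw [E.inner_integral]
    refine (pairing_smul _ c f.2.1).trans ?_
    rw [← E.inner_integral f.2.1]
    exact (inner_smul_right _ _ _).symm
  map_zero' := by
    ext h
    refine ext_inner_left ℂ fun w => ?_
    rw [E.inner_integral]
    exact (pairing_zero _).trans (inner_zero_right w).symm
  map_add' f g := by
    ext h
    refine ext_inner_left ℂ fun w => ?_
    rw [E.inner_integral, _root_.add_apply, inner_add_right, E.inner_integral, E.inner_integral]
    exact pairing_add _ f.2.1 g.2.1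
  map_mul' f g := E.integral_mul f g
  map_star' f := (E.adjoint_integral f).symm

end entries

end NSpace

namespace NSpace

open Filter Topology
open scoped CompactlySupported Matrix.Norms.L2Operator

/-! ### The operator-valued `n`-measure of a representation -/

section existence

variable {n : ℕ} {X : Type*} [TopologicalSpace X] [T2Space X] [LocallyCompactSpace X]
  [MulAction (PU n) X] [ContinuousSMul (PU n) X]
  {H : Type*} [NormedAddCommGroup H] [InnerProductSpace ℂ H] [CompleteSpace H]
  (π : CStar n X →⋆ₙₐ[ℂ] (H →L[ℂ] H))

/-- As a closed *-subalgebra, C*(X, .) is a C*-algebra, and *-homomorphisms between C*-algebras are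
contractive. No continuity of π has to be assumed. -/
lemma norm_representation_le (f : CStar n X) :
    ‖π f‖ ≤ ‖(f : C₀(X, Matrix (Fin n) (Fin n) ℂ))‖ := by
  have hcl : IsClosed (CStar n X : Set C₀(X, Matrix (Fin n) (Fin n) ℂ)) := isClosed_CStar
  let _ : NonUnitalCStarAlgebra (CStar n X) :=
    NonUnitalStarSubalgebra.nonUnitalCStarAlgebra (CStar n X) (h_closed := hcl)
  exact NonUnitalStarAlgHom.norm_apply_le π f

/-- The extension `f ↦ π (average f)` of a representation of `C*(X, .)` to `C₀(X, Mₙ)`. -/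
noncomputable def averageRepresentation :
    C₀(X, Matrix (Fin n) (Fin n) ℂ) →L[ℂ] (H →L[ℂ] H) :=
  LinearMap.mkContinuous
    { toFun := fun f => π ⟨average f, average_mem_CStar f⟩
      map_add' := fun f g => by
        rw [← map_add]
        congr 1
        exact Subtype.ext (map_add average f g)
      map_smul' := fun c f => by
        rw [RingHom.id_apply, ← map_smul]
        congr 1
        exact Subtype.ext (map_smul average c f) } ‖average (n := n) (X := X)‖ (fun f =>
      (norm_representation_le π _).trans (average.le_opNorm f))

lemma averageRepresentation_apply (f : C₀(X, Matrix (Fin n) (Fin n) ℂ)) :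
    averageRepresentation π f = π ⟨average f, average_mem_CStar f⟩ := rfl

lemma averageRepresentation_CStar (f : CStar n X) : averageRepresentation π f = π f := by
  rw [averageRepresentation_apply]
  congr 1
  exact Subtype.ext (average_eq_self f.2)

lemma averageRepresentation_rotate (u : PU n) (f : C₀(X, Matrix (Fin n) (Fin n) ℂ)) :
    averageRepresentation π (rotateZeroAtInfty u f) = averageRepresentation π f := by
  rw [averageRepresentation_apply, averageRepresentation_apply]
  congr 1
  exact Subtype.ext (average_rotateZeroAtInfty u f)

/-- With P(b*b) = c*c and c in C*(X, .), the coefficient equals ‖π(c)h‖². -/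
lemma inner_averageRepresentation_star_mul_self (b : C₀(X, Matrix (Fin n) (Fin n) ℂ)) (h : H) :
    ∃ r : ℝ, 0 ≤ r ∧ ⟪h, averageRepresentation π (star b * b) h⟫_ℂ = r := by
  obtain ⟨c, hc, hbc⟩ := exists_average_star_mul_self b
  have h1 : averageRepresentation π (star b * b) = star (π ⟨c, hc⟩) * π ⟨c, hc⟩ := by
    rw [← map_star, ← map_mul, averageRepresentation_apply]
    congr 1
    exact Subtype.ext hbc
  refine ⟨‖π ⟨c, hc⟩ h‖ ^ 2, by positivity, ?_⟩
  have h2 : ⟪h, (star (π ⟨c, hc⟩) * π ⟨c, hc⟩) h⟫_ℂ =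
      ⟪h, ContinuousLinearMap.adjoint (π ⟨c, hc⟩) (π ⟨c, hc⟩ h)⟫_ℂ := rfl
  rw [h1, h2, ContinuousLinearMap.adjoint_inner_right, inner_self_eq_norm_sq_to_K]
  simp

/-- The functional `φ ↦ ⟨π (average (φ a)) h, w⟩`. -/
noncomputable def matrixCoefficient (a : Matrix (Fin n) (Fin n) ℂ) (h w : H) : C₀(X, ℂ) →L[ℂ] ℂ :=
  innerSL ℂ w ∘L (ContinuousLinearMap.apply ℂ H h) ∘L averageRepresentation π ∘L tensor a

lemma matrixCoefficient_apply (a : Matrix (Fin n) (Fin n) ℂ) (h w : H) (φ : C₀(X, ℂ)) :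
    matrixCoefficient π a h w φ = ⟪w, averageRepresentation π (tensor a φ) h⟫_ℂ := rfl

/-! ### Riesz measures of the matrix coefficients. -/

variable [MeasurableSpace X] [BorelSpace X]

/-- For φ ≥ 0 the function φ b*b is the square (√φ b)*(√φ b), so the functional is positive and the
Riesz theorem applies. -/
lemma exists_regular_matrixCoefficient_star_mul_self (b : Matrix (Fin n) (Fin n) ℂ) (h : H) :
    ∃ ν : ComplexMeasure X, IsRegular ν ∧
      ∀ φ : C₀(X, ℂ), matrixCoefficient π (star b * b) h h φ = cintegral φ ν := by
  refine exists_regular_cintegral_of_nonneg _ fun φ hφ => ?_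
  let ψ : C_c(X, ℝ) :=
    { toFun := fun x => Real.sqrt (φ x)
      continuous_toFun := by fun_prop
      hasCompactSupport' := φ.hasCompactSupport.comp_left Real.sqrt_zero }
  have h1 : tensor (star b * b) (realToZeroAtInfty φ) =
      star (tensor b (realToZeroAtInfty ψ)) * tensor b (realToZeroAtInfty ψ) := by
    ext1 x
    have h2 : (φ x : ℂ) = (Real.sqrt (φ x) : ℂ) * (Real.sqrt (φ x) : ℂ) := by
      rw [← Complex.ofReal_mul, Real.mul_self_sqrt (hφ x)]
    have h3 : realToZeroAtInfty ψ x = (Real.sqrt (φ x) : ℂ) := rfl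
    rw [ZeroAtInftyContinuousMap.mul_apply, ZeroAtInftyContinuousMap.star_apply, tensor_apply,
      tensor_apply, h3, realToZeroAtInfty_apply, h2, star_smul, smul_mul_smul_comm]
    simp
  rw [matrixCoefficient_apply, h1]
  exact inner_averageRepresentation_star_mul_self π _ h

lemma inner_apply_polarization (T : H →L[ℂ] H) (h w : H) :
    ⟪w, T h⟫_ℂ = (1 / 4 : ℂ) * (⟪h + w, T (h + w)⟫_ℂ + (-1) * ⟪h + (-1 : ℂ) • w, T (h + (-1 : ℂ) • w)⟫_ℂ +
      Complex.I * ⟪h + Complex.I • w, T (h + Complex.I • w)⟫_ℂ +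
      (-Complex.I) * ⟪h + (-Complex.I) • w, T (h + (-Complex.I) • w)⟫_ℂ) := by
  simp only [map_add, map_smul, inner_add_left, inner_add_right, inner_smul_left, inner_smul_right,
    map_neg, Complex.conj_I, map_one]
  ring_nf
  simp only [Complex.I_sq]
  ring

lemma exists_regular_matrixCoefficient (a : Matrix (Fin n) (Fin n) ℂ) (h w : H) :
    ∃ ν : ComplexMeasure X, IsRegular ν ∧
      ∀ φ : C₀(X, ℂ), matrixCoefficient π a h w φ = cintegral φ ν := by
  have hb : ∀ φ : C₀(X, ℂ), Measurable φ ∧ ∃ C : ℝ, ∀ x, ‖φ x‖ ≤ C := fun φ =>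
    ⟨(map_continuous φ).measurable, ‖φ.toBCF‖, fun x => φ.toBCF.norm_coe_le_norm x⟩
  have hadd : ∀ {L₁ L₂ : C₀(X, ℂ) → ℂ},
      (∃ ν : ComplexMeasure X, IsRegular ν ∧ ∀ φ : C₀(X, ℂ), L₁ φ = cintegral φ ν) →
      (∃ ν : ComplexMeasure X, IsRegular ν ∧ ∀ φ : C₀(X, ℂ), L₂ φ = cintegral φ ν) →
      ∃ ν : ComplexMeasure X, IsRegular ν ∧ ∀ φ : C₀(X, ℂ), L₁ φ + L₂ φ = cintegral φ ν := by
    rintro L₁ L₂ ⟨μ, hμ, hμ'⟩ ⟨ν, hν, hν'⟩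
    refine ⟨μ + ν, hμ.add hν, fun φ => ?_⟩
    rw [cintegral_add_measure_of_bounded _ _ (hb φ).1 (hb φ).2, hμ', hν']
  have hsmul : ∀ {L : C₀(X, ℂ) → ℂ} (c : ℂ),
      (∃ ν : ComplexMeasure X, IsRegular ν ∧ ∀ φ : C₀(X, ℂ), L φ = cintegral φ ν) →
      ∃ ν : ComplexMeasure X, IsRegular ν ∧ ∀ φ : C₀(X, ℂ), c * L φ = cintegral φ ν := by
    rintro L c ⟨ν, hν, hν'⟩
    refine ⟨c • ν, hν.smul c, fun φ => ?_⟩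
    rw [cintegral_smul_measure, hν']
  let _ : PartialOrder (Matrix (Fin n) (Fin n) ℂ) := CStarAlgebra.spectralOrder _
  have _ : StarOrderedRing (Matrix (Fin n) (Fin n) ℂ) := CStarAlgebra.spectralOrderedRing _
  -- Positive matrices span Mₙ, and the coefficient is linear in a, so it suffices to treat a = b*b;
  -- polarization then passes from equal vectors to arbitrary h and w.
  have ha : a ∈ Submodule.span ℂ {a : Matrix (Fin n) (Fin n) ℂ | 0 ≤ a} := by
    rw [CStarAlgebra.span_nonneg]
    trivial
  induction ha using Submodule.span_induction with
  | mem a ha =>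
    rw [Set.mem_ofPred_eq] at ha
    obtain ⟨b, rfl⟩ := CStarAlgebra.nonneg_iff_eq_star_mul_self.1 ha
    have hq := exists_regular_matrixCoefficient_star_mul_self π b
    have := hsmul (1 / 4) (hadd (hadd (hadd (hq (h + w)) (hsmul (-1) (hq (h + (-1 : ℂ) • w))))
      (hsmul Complex.I (hq (h + Complex.I • w))))
      (hsmul (-Complex.I) (hq (h + (-Complex.I) • w))))
    obtain ⟨ν, hν, hν'⟩ := this
    refine ⟨ν, hν, fun φ => ?_⟩
    rw [← hν', matrixCoefficient_apply, inner_apply_polarization]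
    rfl
  | zero =>
    refine ⟨0, isRegular_zero, fun φ => ?_⟩
    have : tensor (0 : Matrix (Fin n) (Fin n) ℂ) φ = 0 := by
      ext1 x
      exact smul_zero _
    rw [matrixCoefficient_apply, this, cintegral_zero_measure]
    simp
  | add a b _ _ ha hb =>
    obtain ⟨ν, hν, hν'⟩ := hadd ha hb
    refine ⟨ν, hν, fun φ => ?_⟩
    rw [← hν', matrixCoefficient_apply, tensor_add, map_add, _root_.add_apply, inner_add_right]
    rfl
  | smul c a _ ha =>
    obtain ⟨ν, hν, hν'⟩ := hsmul c ha
    refine ⟨ν, hν, fun φ => ?_⟩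
    rw [← hν', matrixCoefficient_apply, tensor_smul, map_smul, _root_.smul_apply,
      inner_smul_right]
    rfl

/-- The regular complex measures which represent the matrix coefficients of a representation. -/
noncomputable def coefficientMeasure (h w : H) (j k : Fin n) : ComplexMeasure X :=
  (exists_regular_matrixCoefficient π (Matrix.single k j 1) h w).choose

lemma isRegular_coefficientMeasure (h w : H) (j k : Fin n) :
    IsRegular (coefficientMeasure π h w j k) :=
  (exists_regular_matrixCoefficient π (Matrix.single k j 1) h w).choose_spec.1

lemma cintegral_coefficientMeasure (h w : H) (j k : Fin n) (φ : C₀(X, ℂ)) :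
    cintegral φ (coefficientMeasure π h w j k) =
      ⟪w, averageRepresentation π (tensor (Matrix.single k j 1) φ) h⟫_ℂ :=
  ((exists_regular_matrixCoefficient π (Matrix.single k j 1) h w).choose_spec.2 φ).symm

lemma pairing_coefficientMeasure (h w : H) (f : C₀(X, Matrix (Fin n) (Fin n) ℂ)) :
    pairing (coefficientMeasure π h w) f = ⟪w, averageRepresentation π f h⟫_ℂ := by
  have h1 : f = ∑ j, ∑ k, tensor (Matrix.single j k 1) (entryCLM j k f) := by
    ext1 x
    have h2 : ∀ g : Fin n → Fin n → C₀(X, Matrix (Fin n) (Fin n) ℂ),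
        (∑ j, ∑ k, g j k) x = ∑ j, ∑ k, g j k x := by
      intro g
      let ev : C₀(X, Matrix (Fin n) (Fin n) ℂ) →+ Matrix (Fin n) (Fin n) ℂ :=
        { toFun := fun f => f x, map_zero' := rfl, map_add' := fun _ _ => rfl }
      change ev _ = ∑ j, ∑ k, ev (g j k)
      simp only [map_sum]
    rw [h2]
    conv_lhs => rw [Matrix.matrix_eq_sum_single (f x)]
    refine Finset.sum_congr rfl fun j _ => Finset.sum_congr rfl fun k _ => ?_
    rw [tensor_apply, Matrix.smul_single, smul_eq_mul, mul_one]
    rfl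
  conv_rhs => rw [h1]
  simp only [map_sum, _root_.sum_apply, inner_sum]
  refine Finset.sum_congr rfl fun j _ => Finset.sum_congr rfl fun k _ => ?_
  exact cintegral_coefficientMeasure π h w k j (entryCLM j k f)

/-- The measures were obtained by choice; uniqueness in the Riesz theorem removes the ambiguity and
transfers sesquilinearity from the inner product to them. -/
lemma coefficientMeasure_eq {h w : H} {j k : Fin n} {ν : ComplexMeasure X} (hν : IsRegular ν)
    (h' : ∀ φ : C₀(X, ℂ), ⟪w, averageRepresentation π (tensor (Matrix.single k j 1) φ) h⟫_ℂ =
      cintegral φ ν) : coefficientMeasure π h w j k = ν :=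
  (isRegular_coefficientMeasure π h w j k).eq_of_cintegral_eq hν fun φ => by
    rw [cintegral_coefficientMeasure, h']

/-! ### From coefficient measures to operators. -/

lemma coefficientMeasure_add_left (h h' w : H) (j k : Fin n) :
    coefficientMeasure π (h + h') w j k =
      coefficientMeasure π h w j k + coefficientMeasure π h' w j k :=
  coefficientMeasure_eq π ((isRegular_coefficientMeasure π h w j k).add
    (isRegular_coefficientMeasure π h' w j k)) fun φ => by
    rw [cintegral_add_measure_of_bounded _ _ (map_continuous φ).measurable
      ⟨‖φ.toBCF‖, fun x => φ.toBCF.norm_coe_le_norm x⟩, cintegral_coefficientMeasure,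
      cintegral_coefficientMeasure, map_add, inner_add_right]

lemma coefficientMeasure_add_right (h w w' : H) (j k : Fin n) :
    coefficientMeasure π h (w + w') j k =
      coefficientMeasure π h w j k + coefficientMeasure π h w' j k :=
  coefficientMeasure_eq π ((isRegular_coefficientMeasure π h w j k).add
    (isRegular_coefficientMeasure π h w' j k)) fun φ => by
    rw [cintegral_add_measure_of_bounded _ _ (map_continuous φ).measurable
      ⟨‖φ.toBCF‖, fun x => φ.toBCF.norm_coe_le_norm x⟩, cintegral_coefficientMeasure,
      cintegral_coefficientMeasure, inner_add_left]

lemma coefficientMeasure_smul_left (c : ℂ) (h w : H) (j k : Fin n) :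
    coefficientMeasure π (c • h) w j k = c • coefficientMeasure π h w j k :=
  coefficientMeasure_eq π ((isRegular_coefficientMeasure π h w j k).smul c) fun φ => by
    rw [cintegral_smul_measure, cintegral_coefficientMeasure, map_smul, inner_smul_right]

lemma coefficientMeasure_smul_right (c : ℂ) (h w : H) (j k : Fin n) :
    coefficientMeasure π h (c • w) j k = starRingEnd ℂ c • coefficientMeasure π h w j k :=
  coefficientMeasure_eq π ((isRegular_coefficientMeasure π h w j k).smul _) fun φ => by
    rw [cintegral_smul_measure, cintegral_coefficientMeasure, inner_smul_left]

lemma norm_coefficientMeasure_le (h w : H) (j k : Fin n) (A : Set X) :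
    ‖coefficientMeasure π h w j k A‖ ≤ ‖averageRepresentation π‖ *
      ‖(Matrix.single k j 1 : Matrix (Fin n) (Fin n) ℂ)‖ * ‖w‖ * ‖h‖ := by
  refine (isRegular_coefficientMeasure π h w j k).norm_le (fun φ => ?_) (by positivity) A
  rw [cintegral_coefficientMeasure]
  calc _ ≤ ‖w‖ * ‖averageRepresentation π (tensor (Matrix.single k j 1) φ) h‖ :=
        norm_inner_le_norm _ _
    _ ≤ ‖w‖ * (‖averageRepresentation π‖ *
          (‖(Matrix.single k j 1 : Matrix (Fin n) (Fin n) ℂ)‖ * ‖φ‖) * ‖h‖) := by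
        gcongr
        refine ContinuousLinearMap.le_of_opNorm_le _ ?_ h
        exact ((averageRepresentation π).le_opNorm _).trans
          (mul_le_mul_of_nonneg_left (norm_tensor_apply_le _ _) (norm_nonneg _))
    _ = _ := by ring

/-- The operator `T` with `⟨T h, w⟩ = ν_{jk}^{(h,w)}(A)`. -/
noncomputable def coefficientOperator (A : Set X) (j k : Fin n) : H →L[ℂ] H :=
  ContinuousLinearMap.adjoint (InnerProductSpace.continuousLinearMapOfBilin
    (LinearMap.mkContinuousOfExistsBound₂
      (LinearMap.mk₂'ₛₗ (starRingEnd ℂ) (RingHom.id ℂ)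
        (fun w h => coefficientMeasure π h w j k A)
        (fun w w' h => by rw [coefficientMeasure_add_right, _root_.add_apply])
        (fun c w h => by rw [coefficientMeasure_smul_right, _root_.smul_apply])
        (fun w h h' => by rw [coefficientMeasure_add_left, _root_.add_apply])
        (fun c w h => by rw [coefficientMeasure_smul_left, _root_.smul_apply]; rfl))
      ⟨_, fun w h => norm_coefficientMeasure_le π h w j k A⟩))

lemma inner_coefficientOperator (A : Set X) (j k : Fin n) (h w : H) :
    ⟪w, coefficientOperator π A j k h⟫_ℂ = coefficientMeasure π h w j k A := by
  rw [coefficientOperator, ContinuousLinearMap.adjoint_inner_right,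
    InnerProductSpace.continuousLinearMapOfBilin_apply]
  rfl

/-- The functional f ↦ ⟨π(P f)h, w⟩ does not change when f is translated, so uniqueness of the
representing measures gives their covariance. -/
lemma rotateFamily_coefficientMeasure (U : Matrix.unitaryGroup (Fin n) ℂ) (h w : H) :
    rotateFamily U (coefficientMeasure π h w) = coefficientMeasure (X := X) π h w := by
  refine eq_of_pairing_eq (isRegular_rotateFamily U (isRegular_coefficientMeasure π h w))
    (isRegular_coefficientMeasure π h w) fun f => ?_
  rw [pairing_rotateFamily U _ (isBoundedBorel_zeroAtInfty f), pairing_coefficientMeasure,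
    ← averageRepresentation_rotate π (U : PU n) f, ← pairing_coefficientMeasure]
  rfl

/-- The operator-valued `n`-measure of a representation. -/
noncomputable def representationMeasure : OperatorNMeasure n X H where
  toFun A := Matrix.of fun j k => coefficientOperator π A j k
  isMeasure j k h w := ⟨coefficientMeasure π h w j k, fun A =>
    (inner_coefficientOperator π A j k h w).symm⟩
  equivariant u A hA := by
    induction u using QuotientGroup.induction_on with
    | H U =>
      ext j k h
      refine ext_inner_left ℂ fun w => ?_
      rw [conj_mk, inner_unitaryConj_apply]
      simp only [Matrix.of_apply, inner_coefficientOperator]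
      have h1 : Matrix.of (fun a b => coefficientMeasure π h w a b A) =
          star (U : Matrix (Fin n) (Fin n) ℂ) *
            Matrix.of (fun a b => coefficientMeasure π h w a b ((U : PU n) • A)) *
              (U : Matrix (Fin n) (Fin n) ℂ) := by
        ext a b
        rw [← rotateFamily_apply U _ a b hA, rotateFamily_coefficientMeasure]
        rfl
      have h2 : (U : Matrix (Fin n) (Fin n) ℂ) * star (U : Matrix (Fin n) (Fin n) ℂ) = 1 :=
        Unitary.coe_mul_star_self U
      rw [h1, ← mul_assoc, ← mul_assoc, h2, one_mul, mul_assoc, h2, mul_one, Matrix.of_apply]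

lemma entry_representationMeasure (h w : H) (j k : Fin n) :
    (representationMeasure π).entry j k h w = coefficientMeasure (X := X) π h w j k := by
  ext A hA
  rw [OperatorNMeasure.entry_apply _ _ _ _ _ hA]
  exact inner_coefficientOperator π A j k h w

lemma regular_representationMeasure : (representationMeasure (X := X) π).Regular :=
  fun j k h w => by
    rw [entry_representationMeasure]
    exact isRegular_coefficientMeasure π h w j k

lemma integral_representationMeasure (f : CStar n X) :
    π f = (representationMeasure π).integral (CStar.toBCStar f) (CStar.toBCStar f).2.1 := by
  ext h
  refine ext_inner_left ℂ fun w => ?_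
  rw [OperatorNMeasure.inner_integral]
  have h1 : (representationMeasure π).entries h w = coefficientMeasure (X := X) π h w := by
    ext1 j
    ext1 k
    exact entry_representationMeasure π h w j k
  rw [h1, ← averageRepresentation_CStar, ← pairing_coefficientMeasure]
  rfl

/-- The spectral `n`-measure of a representation. -/
noncomputable def spectralMeasure : SpectralNMeasure n X H where
  toOperatorNMeasure := representationMeasure π
  regular := regular_representationMeasure π
  adjoint_integral f := OperatorNMeasure.adjoint_integral_of_representation
    (regular_representationMeasure π) (integral_representationMeasure π) f.2.1
  integral_mul := OperatorNMeasure.integral_mul_of_representation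
    (regular_representationMeasure π) (integral_representationMeasure π)

end existence

end NSpace

theorem mainTheorem3 (n : ℕ) (hn : 1 ≤ n)
    {X : Type*} [TopologicalSpace X] [T2Space X] [LocallyCompactSpace X]
    [MeasurableSpace X] [BorelSpace X]
    [MulAction (NSpace.PU n) X] [ContinuousSMul (NSpace.PU n) X]
    (hfree : ∀ (u : NSpace.PU n) (x : X), u • x = x → u = 1)
    {H : Type*} [NormedAddCommGroup H] [InnerProductSpace ℂ H] [CompleteSpace H]
    (π : NSpace.CStar n X →⋆ₙₐ[ℂ] (H →L[ℂ] H)) :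
    (∃! E : NSpace.SpectralNMeasure n X H, ∀ f : NSpace.CStar n X,
      π f = E.integral (NSpace.CStar.toBCStar f) (NSpace.CStar.toBCStar f).2.1) ∧
    ∃ ρ : NSpace.BCStar n X →⋆ₙₐ[ℂ] (H →L[ℂ] H),
      ∀ f : NSpace.CStar n X, ρ (NSpace.CStar.toBCStar f) = π f := by
  refine ⟨⟨NSpace.spectralMeasure π, NSpace.integral_representationMeasure π, fun F hF => ?_⟩,
    (NSpace.spectralMeasure π).representation,
    fun f => (NSpace.integral_representationMeasure π f).symm⟩
  have h1 : F.toOperatorNMeasure = NSpace.representationMeasure π :=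
    NSpace.OperatorNMeasure.eq_of_integral_eq F.regular (NSpace.regular_representationMeasure π)
      fun f => (hF f).symm.trans (NSpace.integral_representationMeasure π f)
  -- The remaining fields of a spectral measure are propositions, so equality of the underlying
  -- operator measures suffices.
  obtain ⟨F, _, _, _⟩ := F
  cases h1
  rfl
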